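/- Let $c\in\{1,-1\}$, let $f\in C^1(\mathbb{R},\mathbb{R})$ satisfy $f'>0$ and $f(0)=0$, and let $g\in C^1(\mathbb{R},\mathbb{R})$ satisfy, for some constant $0\le\gamma<1$, $|g|\le\gamma|f|$ and $|g'|\le\gamma|f'|$ on $\mathbb{R}$. Let $T=2\pi/\omega>0$, and let $H^1_\sharp$ be the space of real $T$-periodic functions on $\mathbb{R}$ that are locally absolutely continuous and whose derivative is square integrable over a period, with norm $\|y\|_{H^1_\sharp}=\bigl(\int_0^T (y^2+y'^2)\,dt\bigr)^{1/2}$. Put $\Omega(n)=\bigl(2n+\tfrac{1+c}{2}\bigr)\pi$ for $n\in\mathbb{Z}$ and $d=f'(0)-c\,g'(0)$, and let $\phi:\mathbb{Z}\to\mathbb{Z}$ be such that $|k\omega-\Omega(\phi(k))|=\min_{n\in\mathbb{Z}}|k\omega-\Omega(n)|$ for all $k\in\mathbb{Z}$. Assume $$\liminf_{|k|\to\infty}\Bigl|\,d-\Omega(\phi(k))\bigl(k\omega-\Omega(\phi(k))\bigr)\Bigr|>0$$ (the value $+\infty$ being allowed). Then, for sources $s\in H^1_\sharp$ that are small, the equation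 $$y'(t)+c\,y'(t-1)+f(y(t))+g(y(t-1))=s(t)\qquad\text{for almost every } t\in\mathbb{R}$$ has a unique $T$-periodic solution in any given bounded neighbourhood of the origin of $H^1_\sharp$. Precisely: for every $R>0$ there is $\varepsilon>0$ such that, for every $s\in H^1_\sharp$ with $\|s\|_{H^1_\sharp}\le\varepsilon$, there is exactly one $y\in H^1_\sharp$ with $\|y\|_{H^1_\sharp}\le R$ that satisfies this equation. -/

import Mathlib

open MeasureTheory

/-- The Sobolev space `H^1_♯` of real `T`-periodic functions on the line, each class being given by
its continuous representative: `y` is `T`-periodic, locally absolutely continuous, and its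
almost everywhere defined derivative, which is its weak derivative, is square integrable over one
period. -/
structure MemH1Per (T : ℝ) (y : ℝ → ℝ) : Prop where
  periodic : Function.Periodic y T
  absolutelyContinuous : ∀ a b : ℝ, AbsolutelyContinuousOnInterval y a b
  memLp_deriv : MemLp (deriv y) 2 (volume.restrict (Set.Ioc 0 T))

/-- The norm of `H^1_♯`: the square root of `∫_0^T (y² + y'²)`. -/
noncomputable def h1PerNorm (T : ℝ) (y : ℝ → ℝ) : ℝ :=
  Real.sqrt (∫ t in (0 : ℝ)..T, ((y t) ^ 2 + (deriv y t) ^ 2))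

/-- `y` solves `y'(t) + c y'(t-1) + f(y(t)) + g(y(t-1)) = s(t)` for almost every real `t`. -/
def SolvesNDDE (c : ℝ) (f g s y : ℝ → ℝ) : Prop :=
  ∀ᵐ t : ℝ, deriv y t + c * deriv y (t - 1) + f (y t) + g (y (t - 1)) = s t

/-- The asymptotic root frequencies `Ω(n) = (2 n + (1 + c) / 2) π`. -/
noncomputable def rootFreq (c : ℝ) (n : ℤ) : ℝ :=
  (2 * (n : ℝ) + (1 + c) / 2) * Real.pi

/-!
# Small periodic solutions of a neutral delay differential equation

Write `a = f'(0)`, `b = g'(0)`, `p(x) = f(x) - a x`, `q(x) = g(x) - b x`. The equation becomes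
`L y = s - p(y) - q(y(· - 1))` with the linear operator `L y = y' + c y'(· - 1) + a y + b y(· - 1)`,
which acts on Fourier coefficients as multiplication by the symbol
`σ(k) = i k ω + a + exp(-i k ω) (i c k ω + b)`.

*The symbol is bounded away from zero* (`exists_le_norm_nddeSymbol`). Since `|b| < a`, no `σ(k)`
vanishes. If `σ(k)` is small then the distance `δ` of `k ω` from the nearest root frequency `Ω` is
`O(1 / |k|)`, and then `σ(k) = d - Ω δ + O(1 / |k|)`, so the Diophantine hypothesis applies to all
but finitely many `k`. Hence `L` is boundedly invertible on `L²`, and since its inverse commutes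
with differentiation, also on `H^1_♯`. There is no gain of derivatives.

*Existence* (`exists_nddeLinear_ae_eq_source_sub`). As `p` and `q` are only `C¹`, the nonlinearity
need not be Lipschitz for the norm of `H^1_♯`. It does map a small ball of `H^1_♯` to a much smaller
one, and it is Lipschitz with a small constant for the `L²` norm on that ball. A ball of `H^1_♯` is
closed in `L²`, as one sees on Fourier coefficients, so the contraction principle for the `L²`
distance yields a solution.

*Uniqueness* (`MemH1Per.energy_estimate`, `exists_abs_le_of_solvesNDDE`). With `u = y' + f(y)` and
`v = c y'(· - 1) + g(y(· - 1))` the equation is `u + v = s`. Over a period `y'` is orthogonal to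
`f(y)` and to `g(y)`, so `‖u‖² - ‖v‖² = ‖f(y)‖² - ‖g(y)‖² ≥ (1 - γ²) ‖f(y)‖²`, whereas
`‖u‖² - ‖v‖² = ⟪u - v, s⟫` is small with `s`. Therefore every solution in a given ball of `H^1_♯` is
small in `L²`, hence uniformly small by interpolation, and the `L²` contraction estimate shows that
two such solutions coincide.
-/

/-! ### Periodic square integrable functions -/

/-- Real `T`-periodic functions, defined everywhere, that are square integrable over a period. -/
structure MemL2Per (T : ℝ) (u : ℝ → ℝ) : Prop where
  periodic : Function.Periodic u T
  memLp : MemLp u 2 (volume.restrict (Set.Ioc 0 T))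

/-- A property that is invariant under translation by `T` and holds almost everywhere on a period
holds almost everywhere. -/
theorem ae_of_ae_restrict_Ioc_of_periodic {T : ℝ} (hT : 0 < T) {P : ℝ → Prop}
    (hP : ∀ t, P (t + T) ↔ P t) (h : ∀ᵐ t ∂volume.restrict (Set.Ioc 0 T), P t) :
    ∀ᵐ t, P t := by
  have hper : Function.Periodic P T := fun t => propext (hP t)
  have hfd := isAddFundamentalDomain_Ioc hT 0 (volume : Measure ℝ)
  rw [ae_iff]
  refine hfd.measure_zero_of_invariant _ ?_ ?_
  · rintro ⟨g, hg⟩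
    obtain ⟨n, rfl⟩ := AddSubgroup.mem_zmultiples_iff.1 hg
    ext x
    rw [Set.mem_vadd_set_iff_neg_vadd_mem]
    change ¬ P (-(n • T) + x) ↔ ¬ P x
    have h := hper.zsmul n (-(n • T) + x)
    rw [← h]
    simp [add_comm]
  · rw [ae_restrict_iff' measurableSet_Ioc] at h
    rw [zero_add]
    refine measure_mono_null ?_ (ae_iff.1 h)
    rintro x ⟨hx, hxs⟩
    exact fun hc => hx (hc hxs)

theorem ae_comp_sub {P : ℝ → Prop} (h : ∀ᵐ t : ℝ, P t) (τ : ℝ) : ∀ᵐ t : ℝ, P (t - τ) :=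
  (measurePreserving_sub_right volume τ).quasiMeasurePreserving.ae h

theorem intervalIntegral_comp_sub_of_periodic {E : Type*} [NormedAddCommGroup E] [NormedSpace ℝ E]
    {T : ℝ} {u : ℝ → E} (hu : Function.Periodic u T) (τ : ℝ) :
    ∫ t in (0 : ℝ)..T, u (t - τ) = ∫ t in (0 : ℝ)..T, u t := by
  rw [intervalIntegral.integral_comp_sub_right]
  have := hu.intervalIntegral_add_eq (0 - τ) 0
  rw [zero_add] at this
  rw [← this]
  congr 1
  ring

namespace MemL2Per

variable {T : ℝ} {u v : ℝ → ℝ}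

theorem add (hu : MemL2Per T u) (hv : MemL2Per T v) : MemL2Per T (fun t => u t + v t) :=
  ⟨hu.periodic.add hv.periodic, hu.memLp.add hv.memLp⟩

theorem sub (hu : MemL2Per T u) (hv : MemL2Per T v) : MemL2Per T (fun t => u t - v t) :=
  ⟨hu.periodic.sub hv.periodic, hu.memLp.sub hv.memLp⟩

theorem const_mul (hu : MemL2Per T u) (a : ℝ) : MemL2Per T (fun t => a * u t) :=
  ⟨fun t => by simp only [hu.periodic t], hu.memLp.const_mul a⟩

theorem of_continuous (hu : Function.Periodic u T) (hc : Continuous u) : MemL2Per T u := by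
  refine ⟨hu, ?_⟩
  obtain ⟨C, hC⟩ := isCompact_Icc.exists_bound_of_continuousOn (s := Set.Icc 0 T) hc.continuousOn
  refine MemLp.of_bound hc.aestronglyMeasurable C ?_
  rw [ae_restrict_iff' measurableSet_Ioc]
  exact .of_forall fun t ht => hC t (Set.Ioc_subset_Icc_self ht)

theorem continuous_mul (hu : MemL2Per T u) (hv : Function.Periodic v T) (hc : Continuous v) :
    MemL2Per T (fun t => v t * u t) := by
  refine ⟨hv.mul hu.periodic, ?_⟩
  obtain ⟨C, hC⟩ := isCompact_Icc.exists_bound_of_continuousOn (s := Set.Icc 0 T) hc.continuousOn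
  refine hu.memLp.of_le_mul (c := C) (hc.aestronglyMeasurable.mul hu.memLp.1) ?_
  rw [ae_restrict_iff' measurableSet_Ioc]
  refine .of_forall fun t ht => ?_
  rw [norm_mul]
  exact mul_le_mul_of_nonneg_right (hC t (Set.Ioc_subset_Icc_self ht)) (norm_nonneg _)

theorem comp_sub (hT : 0 < T) (hu : MemL2Per T u) (τ : ℝ) : MemL2Per T (fun t => u (t - τ)) := by
  refine ⟨fun t => by simp only [← hu.periodic (t - τ)]; congr 1; ring, ?_⟩
  have h0 := isAddFundamentalDomain_Ioc hT 0 (volume : Measure ℝ)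
  have h1 := isAddFundamentalDomain_Ioc hT (-τ) (volume : Measure ℝ)
  have hinv : ∀ {w : ℝ → ℝ}, Function.Periodic w T →
      ∀ (g : AddSubgroup.zmultiples T) (x : ℝ), w (g +ᵥ x) = w x := by
    rintro w hw ⟨g, hg⟩ x
    obtain ⟨n, rfl⟩ := AddSubgroup.mem_zmultiples_iff.1 hg
    change w (n • T + x) = w x
    rw [add_comm, hw.zsmul n x]
  have hmeas : AEStronglyMeasurable u (volume.restrict (Set.Ioc (-τ) (-τ + T))) := by
    rw [← h0.aestronglyMeasurable_on_iff h1 (hinv hu.periodic), zero_add]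
    exact hu.memLp.1
  have hsq : Function.Periodic (fun t => u t ^ 2) T := fun t => by simp only [hu.periodic t]
  have hL : MemLp u 2 (volume.restrict (Set.Ioc (-τ) (-τ + T))) := by
    rw [memLp_two_iff_integrable_sq hmeas]
    refine (h0.integrableOn_iff h1 (hinv hsq)).1 ?_
    rw [zero_add]
    exact hu.memLp.integrable_sq
  refine hL.comp_measurePreserving ?_
  have := (measurePreserving_sub_right (volume : Measure ℝ) τ).restrict_preimage
    (s := Set.Ioc (-τ) (-τ + T)) measurableSet_Ioc
  convert this using 2
  ext x
  simp only [Set.mem_preimage, Set.mem_Ioc]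
  constructor <;> rintro ⟨h, h'⟩ <;> constructor <;> linarith

theorem intervalIntegrable_mul (hT : 0 < T) (hu : MemL2Per T u) (hv : MemL2Per T v) (a b : ℝ) :
    IntervalIntegrable (fun t => u t * v t) volume a b := by
  refine (hu.periodic.mul hv.periodic).intervalIntegrable (t := 0) hT.ne' ?_ a b
  rw [zero_add, intervalIntegrable_iff_integrableOn_Ioc_of_le hT.le]
  exact hu.memLp.integrable_mul hv.memLp

theorem intervalIntegrable (hT : 0 < T) (hu : MemL2Per T u) (a b : ℝ) :
    IntervalIntegrable u volume a b := by
  have := hu.intervalIntegrable_mul hT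
    (of_continuous (u := fun _ => 1) (fun _ => rfl) continuous_const) a b
  simpa using this

theorem intervalIntegrable_sq (hT : 0 < T) (hu : MemL2Per T u) (a b : ℝ) :
    IntervalIntegrable (fun t => u t ^ 2) volume a b := by
  simpa only [sq] using hu.intervalIntegrable_mul hT hu a b

end MemL2Per

/-! ### The space of periodic functions with a square integrable derivative -/

namespace MemH1Per

variable {T : ℝ} {y z : ℝ → ℝ}

theorem continuous (hy : MemH1Per T y) : Continuous y := by
  rw [continuous_iff_continuousAt]
  intro t
  refine (hy.absolutelyContinuous (t - 1) (t + 1)).continuousOn.continuousAt ?_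
  rw [Set.uIcc_of_le (by linarith)]
  exact Icc_mem_nhds (by linarith) (by linarith)

theorem periodic_deriv (hy : MemH1Per T y) : Function.Periodic (deriv y) T := by
  intro t
  rw [← deriv_comp_add_const]
  congr 1
  exact funext hy.periodic

theorem memL2Per (hy : MemH1Per T y) : MemL2Per T y := .of_continuous hy.periodic hy.continuous

theorem memL2Per_deriv (hy : MemH1Per T y) : MemL2Per T (deriv y) :=
  ⟨hy.periodic_deriv, hy.memLp_deriv⟩

end MemH1Per

theorem ae_differentiableAt_of_absolutelyContinuousOnInterval {y : ℝ → ℝ}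
    (hy : ∀ a b : ℝ, AbsolutelyContinuousOnInterval y a b) : ∀ᵐ t, DifferentiableAt ℝ y t := by
  have : ∀ᵐ t : ℝ, ∀ n : ℕ, t ∈ Set.uIcc (-n : ℝ) n → DifferentiableAt ℝ y t :=
    ae_all_iff.2 fun n => (hy _ _).ae_differentiableAt
  filter_upwards [this] with t ht
  obtain ⟨n, hn⟩ := exists_nat_ge |t|
  refine ht n ?_
  rw [Set.uIcc_of_le (by linarith [abs_nonneg t])]
  exact abs_le.1 hn

namespace MemH1Per

variable {T : ℝ} {y z : ℝ → ℝ}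

theorem ae_differentiableAt (hy : MemH1Per T y) : ∀ᵐ t, DifferentiableAt ℝ y t :=
  ae_differentiableAt_of_absolutelyContinuousOnInterval hy.absolutelyContinuous

theorem integral_deriv (hy : MemH1Per T y) (a b : ℝ) :
    ∫ t in a..b, deriv y t = y b - y a :=
  (hy.absolutelyContinuous a b).integral_deriv_eq_sub

theorem integral_deriv_period (hy : MemH1Per T y) : ∫ t in (0 : ℝ)..T, deriv y t = 0 := by
  rw [hy.integral_deriv, ← zero_add T, hy.periodic, sub_self]

theorem deriv_add_ae (hy : MemH1Per T y) (hz : MemH1Per T z) :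
    deriv (fun t => y t + z t) =ᵐ[volume] fun t => deriv y t + deriv z t := by
  filter_upwards [hy.ae_differentiableAt, hz.ae_differentiableAt] with t h1 h2
  exact deriv_fun_add h1 h2

theorem deriv_sub_ae (hy : MemH1Per T y) (hz : MemH1Per T z) :
    deriv (fun t => y t - z t) =ᵐ[volume] fun t => deriv y t - deriv z t := by
  filter_upwards [hy.ae_differentiableAt, hz.ae_differentiableAt] with t h1 h2
  exact deriv_fun_sub h1 h2

/-- A periodic, locally absolutely continuous function whose derivative agrees almost everywhere
with a square integrable periodic function is in `H^1_♯`. -/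
theorem of_deriv_ae {v : ℝ → ℝ} (hy : Function.Periodic y T)
    (hac : ∀ a b : ℝ, AbsolutelyContinuousOnInterval y a b) (hv : MemL2Per T v)
    (h : deriv y =ᵐ[volume] v) : MemH1Per T y :=
  ⟨hy, hac, hv.memLp.ae_eq (ae_restrict_of_ae h.symm)⟩

theorem add (hy : MemH1Per T y) (hz : MemH1Per T z) : MemH1Per T (fun t => y t + z t) :=
  of_deriv_ae (hy.periodic.add hz.periodic)
    (fun a b => (hy.absolutelyContinuous a b).add (hz.absolutelyContinuous a b))
    (hy.memL2Per_deriv.add hz.memL2Per_deriv) (hy.deriv_add_ae hz)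

theorem sub (hy : MemH1Per T y) (hz : MemH1Per T z) : MemH1Per T (fun t => y t - z t) :=
  of_deriv_ae (hy.periodic.sub hz.periodic)
    (fun a b => (hy.absolutelyContinuous a b).sub (hz.absolutelyContinuous a b))
    (hy.memL2Per_deriv.sub hz.memL2Per_deriv) (hy.deriv_sub_ae hz)

theorem deriv_comp_ae (hy : MemH1Per T y) {p : ℝ → ℝ} (hp : ContDiff ℝ 1 p) :
    deriv (fun t => p (y t)) =ᵐ[volume] fun t => deriv p (y t) * deriv y t := by
  filter_upwards [hy.ae_differentiableAt] with t ht
  exact deriv_comp t (hp.differentiable one_ne_zero (y t)) ht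

end MemH1Per

/-- A `C¹` function maps absolutely continuous functions to absolutely continuous functions, being
Lipschitz on their bounded range. -/
theorem AbsolutelyContinuousOnInterval.contDiff_comp {p y : ℝ → ℝ} {a b : ℝ}
    (hy : AbsolutelyContinuousOnInterval y a b) (hp : ContDiff ℝ 1 p) :
    AbsolutelyContinuousOnInterval (fun t => p (y t)) a b := by
  obtain ⟨C, hC⟩ := hy.exists_bound
  obtain ⟨K, hK⟩ := hp.contDiffOn.exists_lipschitzOnWith (s := Set.Icc (-C) C) (by decide)
    (convex_Icc _ _) isCompact_Icc
  have hmem : ∀ t ∈ Set.uIcc a b, y t ∈ Set.Icc (-C) C := fun t ht => abs_le.1 (hC t ht)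
  rw [absolutelyContinuousOnInterval_iff] at hy ⊢
  intro ε hε
  obtain ⟨δ, hδ, h⟩ := hy (ε / (K + 1)) (by positivity)
  refine ⟨δ, hδ, fun E hE hE' => ?_⟩
  have h2 := h E hE hE'
  calc _ ≤ ∑ i ∈ Finset.range E.1, (K : ℝ) * dist (y (E.2 i).1) (y (E.2 i).2) := by
        refine Finset.sum_le_sum fun i hi => ?_
        exact hK.dist_le_mul _ (hmem _ (hE.1 i hi).1) _ (hmem _ (hE.1 i hi).2)
    _ = (K : ℝ) * ∑ i ∈ Finset.range E.1, dist (y (E.2 i).1) (y (E.2 i).2) :=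
        (Finset.mul_sum _ _ _).symm
    _ ≤ K * (ε / (K + 1)) := by gcongr
    _ < (K + 1) * (ε / (K + 1)) := by gcongr; linarith
    _ = ε := by field

theorem AbsolutelyContinuousOnInterval.comp_sub_const {y : ℝ → ℝ} {a b : ℝ} (τ : ℝ)
    (hy : AbsolutelyContinuousOnInterval y (a - τ) (b - τ)) :
    AbsolutelyContinuousOnInterval (fun t => y (t - τ)) a b := by
  rw [absolutelyContinuousOnInterval_iff] at hy ⊢
  intro ε hε
  obtain ⟨δ, hδ, h⟩ := hy ε hε
  refine ⟨δ, hδ, fun E hE hE' => ?_⟩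
  refine h (E.1, fun i => ((E.2 i).1 - τ, (E.2 i).2 - τ)) ⟨?_, ?_⟩ (by simpa using hE')
  · intro i hi
    obtain ⟨h1, h2⟩ := hE.1 i hi
    rw [← Set.image_sub_const_uIcc]
    exact ⟨⟨_, h1, rfl⟩, ⟨_, h2, rfl⟩⟩
  · intro i hi j hj hij
    have := hE.2 hi hj hij
    simp only [Function.onFun, Set.disjoint_left] at this ⊢
    intro x hx hx'
    refine @this (x + τ) ?_ ?_
    · simp only [Set.mem_uIoc] at hx ⊢
      rcases hx with ⟨h1, h2⟩ | ⟨h1, h2⟩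
      · exact .inl ⟨by linarith, by linarith⟩
      · exact .inr ⟨by linarith, by linarith⟩
    · simp only [Set.mem_uIoc] at hx' ⊢
      rcases hx' with ⟨h1, h2⟩ | ⟨h1, h2⟩
      · exact .inl ⟨by linarith, by linarith⟩
      · exact .inr ⟨by linarith, by linarith⟩

namespace MemH1Per

variable {T : ℝ} {y z : ℝ → ℝ}

theorem comp (hy : MemH1Per T y) {p : ℝ → ℝ} (hp : ContDiff ℝ 1 p) :
    MemH1Per T (fun t => p (y t)) := by
  refine of_deriv_ae (fun t => by simp only [hy.periodic t])
    (fun a b => (hy.absolutelyContinuous a b).contDiff_comp hp) ?_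
    (hy.deriv_comp_ae hp)
  exact hy.memL2Per_deriv.continuous_mul (fun t => by simp only [hy.periodic t])
    ((hp.continuous_deriv le_rfl).comp hy.continuous)

theorem comp_sub (hT : 0 < T) (hy : MemH1Per T y) (τ : ℝ) : MemH1Per T (fun t => y (t - τ)) := by
  refine of_deriv_ae (v := fun t => deriv y (t - τ)) (hy.memL2Per.comp_sub hT τ).periodic
    (fun a b => (hy.absolutelyContinuous _ _).comp_sub_const τ)
    (hy.memL2Per_deriv.comp_sub hT τ) ?_
  exact .of_forall fun t => deriv_comp_sub_const ..

/-- The integral of a mean zero periodic square integrable function is in `H^1_♯`. -/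
theorem of_integral (hT : 0 < T) {v : ℝ → ℝ} (hv : MemL2Per T v)
    (hmean : ∫ t in (0 : ℝ)..T, v t = 0) (C : ℝ) :
    MemH1Per T (fun t => C + ∫ x in (0 : ℝ)..t, v x) ∧
      deriv (fun t => C + ∫ x in (0 : ℝ)..t, v x) =ᵐ[volume] v := by
  have hint := hv.intervalIntegrable hT
  have hd : deriv (fun t => C + ∫ x in (0 : ℝ)..t, v x) =ᵐ[volume] v := by
    have hloc : LocallyIntegrable v volume := by
      rw [locallyIntegrable_iff]
      intro k hk
      obtain ⟨R, hR⟩ := hk.isBounded.subset_closedBall 0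
      rw [Real.closedBall_eq_Icc] at hR
      refine IntegrableOn.mono_set ?_ (hR.trans (Set.Icc_subset_uIcc))
      exact (intervalIntegrable_iff' (by simp)).1 (hint _ _)
    filter_upwards [LocallyIntegrable.ae_hasDerivAt_integral hloc] with t ht
    exact ((ht 0).const_add C).deriv
  refine ⟨of_deriv_ae ?_ ?_ hv hd, hd⟩
  · intro t
    simp only
    rw [← intervalIntegral.integral_add_adjacent_intervals (hint 0 t) (hint t (t + T)),
      hv.periodic.intervalIntegral_add_eq t 0, zero_add, hmean, add_zero]
  · intro a b
    have h1 : AbsolutelyContinuousOnInterval (fun x ↦ ∫ v_1 in a..x, v v_1) a b :=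
      (hint a b).absolutelyContinuousOnInterval_intervalIntegral Set.left_mem_uIcc
    have h2 : AbsolutelyContinuousOnInterval (fun _ : ℝ => C + ∫ x in (0 : ℝ)..a, v x) a b :=
      contDiff_const.contDiffOn.absolutelyContinuousOnInterval
    refine (congrArg (AbsolutelyContinuousOnInterval · a b) (funext fun t => ?_)).mp (h2.add h1)
    symm
    change _ = (C + ∫ x in (0 : ℝ)..a, v x) + ∫ x in a..t, v x
    rw [add_assoc, intervalIntegral.integral_add_adjacent_intervals (hint 0 a) (hint a t)]

/-- The Sobolev embedding in interpolated form: the supremum is controlled by the `L²` norm of the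
function and an arbitrarily small multiple of that of the derivative. -/
theorem sq_le (hT : 0 < T) (hy : MemH1Per T y) {l : ℝ} (hl : 0 < l) (t : ℝ) :
    y t ^ 2 ≤ (1 / T + l) * (∫ x in (0 : ℝ)..T, y x ^ 2)
      + 1 / l * ∫ x in (0 : ℝ)..T, deriv y x ^ 2 := by
  have h2 := hy.memL2Per.intervalIntegrable_sq hT
  have h2' := hy.memL2Per_deriv.intervalIntegrable_sq hT
  -- the square takes its mean value somewhere, at most a period before `t`
  obtain ⟨s, hs, hsmean⟩ : ∃ s ∈ Set.Icc (t - T) t, y s ^ 2 ≤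
      1 / T * ∫ x in (0 : ℝ)..T, y x ^ 2 := by
    by_contra! hcon
    have hper : Function.Periodic (fun x => y x ^ 2) T := fun x => by simp only [hy.periodic x]
    have hlt : ∫ x in (t - T)..t, (1 / T * ∫ x in (0 : ℝ)..T, y x ^ 2) <
        ∫ x in (t - T)..t, y x ^ 2 := by
      refine intervalIntegral.integral_lt_integral_of_continuousOn_of_le_of_exists_lt
        (by linarith) continuousOn_const (hy.continuous.pow 2).continuousOn
        (fun x hx => (hcon x (Set.Ioc_subset_Icc_self hx)).le)
        ⟨t, ⟨by linarith, le_rfl⟩, hcon t ⟨by linarith, le_rfl⟩⟩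
    have := hper.intervalIntegral_add_eq (t - T) 0
    rw [sub_add_cancel, zero_add] at this
    rw [this, intervalIntegral.integral_const, smul_eq_mul] at hlt
    rw [sub_sub_cancel, ← mul_assoc, mul_one_div_cancel hT.ne', one_mul] at hlt
    exact lt_irrefl _ hlt
  have hsqC : ContDiff ℝ 1 (fun x : ℝ => x ^ 2) := contDiff_id.pow 2
  have hftc := (hy.comp hsqC).integral_deriv s t
  have hbound : ∫ x in s..t, deriv (fun x => y x ^ 2) x ≤
      ∫ x in s..t, (l * y x ^ 2 + 1 / l * deriv y x ^ 2) := by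
    refine intervalIntegral.integral_mono_ae hs.2
      ((hy.comp hsqC).memL2Per_deriv.intervalIntegrable hT _ _)
      (((h2 _ _).const_mul _).add ((h2' _ _).const_mul _)) ?_
    filter_upwards [hy.deriv_comp_ae hsqC] with x hx
    rw [hx]
    have hd : deriv (fun x : ℝ => x ^ 2) (y x) = 2 * y x := by simp
    rw [hd]
    have := mul_nonneg (one_div_pos.2 hl).le (sq_nonneg (l * y x - deriv y x))
    have e : 1 / l * (l * y x - deriv y x) ^ 2 =
      l * y x ^ 2 + 1 / l * deriv y x ^ 2 - 2 * y x * deriv y x := by field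
    linarith
  have hper : Function.Periodic (fun x => l * y x ^ 2 + 1 / l * deriv y x ^ 2) T := fun x => by
    simp only [hy.periodic x, hy.periodic_deriv x]
  have hfull : ∫ x in s..t, (l * y x ^ 2 + 1 / l * deriv y x ^ 2) ≤
      ∫ x in (0 : ℝ)..T, (l * y x ^ 2 + 1 / l * deriv y x ^ 2) := by
    have := hper.intervalIntegral_add_eq (t - T) 0
    rw [sub_add_cancel, zero_add] at this
    rw [← this]
    refine intervalIntegral.integral_mono_interval hs.1 hs.2 le_rfl
      (.of_forall fun x => by positivity) (((h2 _ _).const_mul _).add ((h2' _ _).const_mul _))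
  have hsplit := intervalIntegral.integral_add ((h2 0 T).const_mul l) ((h2' 0 T).const_mul (1 / l))
  rw [intervalIntegral.integral_const_mul, intervalIntegral.integral_const_mul] at hsplit
  linarith

/-- An element of `H^1_♯` with vanishing `L²` norm vanishes identically. -/
theorem eq_zero_of_integral_sq_le_zero (hT : 0 < T) (hy : MemH1Per T y)
    (h : ∫ x in (0 : ℝ)..T, y x ^ 2 ≤ 0) (t : ℝ) : y t = 0 := by
  have h0 : ∫ x in (0 : ℝ)..T, y x ^ 2 = 0 :=
    le_antisymm h (intervalIntegral.integral_nonneg hT.le fun x _ => sq_nonneg _)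
  have hle : ∀ l : ℝ, 0 < l → y t ^ 2 ≤ l * ∫ x in (0 : ℝ)..T, deriv y x ^ 2 := by
    intro l hl
    have := hy.sq_le hT (one_div_pos.2 hl) t
    simpa [h0] using this
  have hD : 0 ≤ ∫ x in (0 : ℝ)..T, deriv y x ^ 2 :=
    intervalIntegral.integral_nonneg hT.le fun x _ => sq_nonneg _
  have : y t ^ 2 ≤ 0 := by
    refine le_of_forall_pos_le_add fun ε hε => ?_
    refine (hle (ε / ((∫ x in (0 : ℝ)..T, deriv y x ^ 2) + 1)) (by positivity)).trans ?_
    rw [zero_add, div_mul_eq_mul_div, div_le_iff₀ (by positivity)]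
    nlinarith
  exact pow_eq_zero_iff two_ne_zero |>.1 (le_antisymm this (sq_nonneg _))

end MemH1Per

/-! ### Fourier coefficients of periodic functions -/

/-- The `k`-th Fourier coefficient of a real function of period `T` and angular frequency
`ω = 2π / T`. -/
noncomputable def perCoeff (ω T : ℝ) (u : ℝ → ℝ) (k : ℤ) : ℂ :=
  (T⁻¹ : ℂ) * ∫ t in (0 : ℝ)..T, Complex.exp (-(k * ω * t) * Complex.I) * u t

section

variable {ω T : ℝ} {u v y : ℝ → ℝ}

theorem IntervalIntegrable.complex_ofReal {w : ℝ → ℝ} {a b : ℝ}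
    (h : IntervalIntegrable w volume a b) :
    IntervalIntegrable (fun t => (w t : ℂ)) volume a b :=
  ⟨h.1.ofReal, h.2.ofReal⟩

theorem fourier_neg_eq_exp (hTω : ω * T = 2 * Real.pi) (hT : 0 < T) (k : ℤ) (t : ℝ) :
    (fourier (-k) (t : AddCircle T) : ℂ) = Complex.exp (-(k * ω * t) * Complex.I) := by
  rw [fourier_coe_apply]
  congr 1
  have h : (ω : ℂ) * T = 2 * Real.pi := by exact_mod_cast hTω
  have hT' : (T : ℂ) ≠ 0 := by exact_mod_cast hT.ne'
  rw [← h]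
  push_cast
  field

theorem perCoeff_eq_fourierCoeffOn (hTω : ω * T = 2 * Real.pi) (hT : 0 < T) (u : ℝ → ℝ) (k : ℤ) :
    perCoeff ω T u k = fourierCoeffOn hT (fun t => (u t : ℂ)) k := by
  rw [fourierCoeffOn_eq_integral, perCoeff]
  simp only [← fourier_neg_eq_exp hTω hT, fourier_coe_apply, sub_zero, smul_eq_mul]
  simp

theorem MemL2Per.hasSum_sq_perCoeff (hTω : ω * T = 2 * Real.pi) (hT : 0 < T) (hu : MemL2Per T u) :
    HasSum (fun k => ‖perCoeff ω T u k‖ ^ 2) (T⁻¹ * ∫ t in (0 : ℝ)..T, u t ^ 2) := by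
  have := hasSum_sq_fourierCoeffOn hT (f := fun t => (u t : ℂ)) hu.memLp.ofReal
  simpa [perCoeff_eq_fourierCoeffOn hTω hT] using this

theorem perCoeff_congr_ae (h : u =ᵐ[volume] v) (k : ℤ) : perCoeff ω T u k = perCoeff ω T v k := by
  unfold perCoeff
  congr 1
  refine intervalIntegral.integral_congr_ae ?_
  filter_upwards [h] with t ht _
  rw [ht]

theorem MemL2Per.intervalIntegrable_exp_mul (hT : 0 < T) (hu : MemL2Per T u) (ω : ℝ) (k : ℤ) :
    IntervalIntegrable (fun t : ℝ => Complex.exp (-(k * ω * t) * Complex.I) * u t)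
      volume 0 T := by
  refine IntervalIntegrable.continuousOn_mul ?_ (by fun_prop)
  exact (hu.intervalIntegrable hT 0 T).complex_ofReal

theorem perCoeff_add (hT : 0 < T) (hu : MemL2Per T u) (hv : MemL2Per T v) (k : ℤ) :
    perCoeff ω T (fun t => u t + v t) k = perCoeff ω T u k + perCoeff ω T v k := by
  unfold perCoeff
  rw [← mul_add, ← intervalIntegral.integral_add (hu.intervalIntegrable_exp_mul hT ω k)
    (hv.intervalIntegrable_exp_mul hT ω k)]
  congr 2
  ext t
  push_cast
  ring

theorem perCoeff_const_mul (a : ℝ) (u : ℝ → ℝ) (k : ℤ) :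
    perCoeff ω T (fun t => a * u t) k = a * perCoeff ω T u k := by
  unfold perCoeff
  rw [mul_left_comm, ← intervalIntegral.integral_const_mul (a : ℂ)]
  congr 1
  refine intervalIntegral.integral_congr fun t _ => ?_
  simp only
  push_cast
  ring

theorem perCoeff_sub (hT : 0 < T) (hu : MemL2Per T u) (hv : MemL2Per T v) (k : ℤ) :
    perCoeff ω T (fun t => u t - v t) k = perCoeff ω T u k - perCoeff ω T v k := by
  have := perCoeff_add (ω := ω) hT hu (hv.const_mul (-1)) k
  rw [perCoeff_const_mul] at this
  simpa [← sub_eq_add_neg] using this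

theorem perCoeff_neg (u : ℝ → ℝ) (k : ℤ) :
    perCoeff ω T u (-k) = (starRingEnd ℂ) (perCoeff ω T u k) := by
  unfold perCoeff
  rw [map_mul, map_inv₀, Complex.conj_ofReal, ← intervalIntegral.intervalIntegral_conj]
  congr 2
  ext t
  rw [map_mul, Complex.conj_ofReal, ← Complex.exp_conj]
  simp

theorem exp_periodic (hTω : ω * T = 2 * Real.pi) (k : ℤ) :
    Function.Periodic (fun t : ℝ => Complex.exp (-(k * ω * t) * Complex.I)) T := by
  intro t
  have h : (ω : ℂ) * T = 2 * Real.pi := by exact_mod_cast hTω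
  simp only
  rw [Complex.exp_eq_exp_iff_exists_int]
  refine ⟨-k, ?_⟩
  push_cast
  linear_combination (-(k : ℂ) * Complex.I) * h

theorem perCoeff_comp_sub (hTω : ω * T = 2 * Real.pi) (hu : Function.Periodic u T) (τ : ℝ)
    (k : ℤ) :
    perCoeff ω T (fun t => u (t - τ)) k =
      Complex.exp (-(k * ω * τ) * Complex.I) * perCoeff ω T u k := by
  unfold perCoeff
  have hper : Function.Periodic
      (fun t : ℝ => Complex.exp (-(k * ω * t) * Complex.I) * (u t : ℂ)) T := by
    refine (exp_periodic hTω k).mul fun t => ?_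
    simp only [hu t]
  rw [← intervalIntegral_comp_sub_of_periodic hper τ, mul_left_comm,
    ← intervalIntegral.integral_const_mul (Complex.exp (-(k * ω * τ) * Complex.I))]
  congr 1
  refine intervalIntegral.integral_congr fun t _ => ?_
  simp only
  rw [← mul_assoc, ← Complex.exp_add]
  congr 2
  push_cast
  ring

/-- The Fourier coefficients of a real function in terms of its cosine and sine integrals. -/
theorem perCoeff_eq_cos_sin (hT : 0 < T) (hu : MemL2Per T u) (k : ℤ) :
    perCoeff ω T u k = (T⁻¹ : ℂ) * ((∫ t in (0 : ℝ)..T, Real.cos (k * ω * t) * u t : ℝ)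
      - (∫ t in (0 : ℝ)..T, Real.sin (k * ω * t) * u t : ℝ) * Complex.I) := by
  unfold perCoeff
  have hc : IntervalIntegrable (fun t => Real.cos (k * ω * t) * u t) volume 0 T :=
    (hu.intervalIntegrable hT 0 T).continuousOn_mul (by fun_prop)
  have hs : IntervalIntegrable (fun t => Real.sin (k * ω * t) * u t) volume 0 T :=
    (hu.intervalIntegrable hT 0 T).continuousOn_mul (by fun_prop)
  rw [← intervalIntegral.integral_ofReal, ← intervalIntegral.integral_ofReal,
    ← intervalIntegral.integral_mul_const, ← intervalIntegral.integral_sub hc.complex_ofReal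
      (hs.complex_ofReal.mul_const _)]
  congr 2
  ext t
  rw [Complex.exp_mul_I]
  push_cast
  rw [Complex.cos_neg, Complex.sin_neg]
  ring

theorem MemH1Per.perCoeff_deriv (hTω : ω * T = 2 * Real.pi) (hT : 0 < T) (hy : MemH1Per T y)
    (k : ℤ) :
    perCoeff ω T (deriv y) k = (k * ω * Complex.I) * perCoeff ω T y k := by
  rw [perCoeff_eq_cos_sin hT hy.memL2Per_deriv, perCoeff_eq_cos_sin hT hy.memL2Per]
  have hyT : y T = y 0 := by simpa using hy.periodic 0
  have hang : (k : ℝ) * ω * T = k * (2 * Real.pi) := by rw [mul_assoc, hTω]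
  have hcC : ContDiff ℝ 1 (fun t : ℝ => Real.cos (k * ω * t)) := by fun_prop
  have hsC : ContDiff ℝ 1 (fun t : ℝ => Real.sin (k * ω * t)) := by fun_prop
  have hcd : deriv (fun t : ℝ => Real.cos (k * ω * t)) =
      fun t => -(k * ω) * Real.sin (k * ω * t) := by
    ext t
    have h := ((hasDerivAt_id t).const_mul ((k : ℝ) * ω)).cos
    simp only [id] at h
    rw [h.deriv]
    ring
  have hsd : deriv (fun t : ℝ => Real.sin (k * ω * t)) =
      fun t => (k * ω) * Real.cos (k * ω * t) := by
    ext t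
    have h := ((hasDerivAt_id t).const_mul ((k : ℝ) * ω)).sin
    simp only [id] at h
    rw [h.deriv]
    ring
  have h1 := AbsolutelyContinuousOnInterval.integral_mul_deriv_eq_deriv_mul
    (hcC.contDiffOn.absolutelyContinuousOnInterval) (hy.absolutelyContinuous 0 T)
  have h2 := AbsolutelyContinuousOnInterval.integral_mul_deriv_eq_deriv_mul
    (hsC.contDiffOn.absolutelyContinuousOnInterval) (hy.absolutelyContinuous 0 T)
  rw [hcd] at h1
  rw [hsd] at h2
  simp only [hang, Real.cos_int_mul_two_pi, mul_zero, Real.cos_zero, hyT, mul_assoc,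
    intervalIntegral.integral_const_mul, sub_self, zero_sub] at h1
  have hsin : Real.sin (k * (2 * Real.pi)) = 0 := by
    have := Real.sin_int_mul_pi (k * 2)
    push_cast at this
    rwa [mul_assoc] at this
  simp only [hang, hsin, mul_zero, Real.sin_zero, zero_mul, mul_assoc,
    intervalIntegral.integral_const_mul, sub_self, zero_sub] at h2
  simp only [mul_assoc]
  rw [h1, h2]
  push_cast
  linear_combination ((T⁻¹ : ℂ) * (k * (ω *
    ((∫ t in (0 : ℝ)..T, Real.sin (k * (ω * t)) * y t : ℝ) : ℂ)))) * Complex.I_sq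

/-- Square integrable periodic functions with the same Fourier coefficients agree almost
everywhere. -/
theorem MemL2Per.ae_eq_of_perCoeff_eq (hTω : ω * T = 2 * Real.pi) (hT : 0 < T) (hu : MemL2Per T u)
    (hv : MemL2Per T v) (h : ∀ k, perCoeff ω T u k = perCoeff ω T v k) : u =ᵐ[volume] v := by
  have hsum := (hu.sub hv).hasSum_sq_perCoeff hTω hT
  simp only [perCoeff_sub hT hu hv, h, sub_self, norm_zero, ne_eq, OfNat.ofNat_ne_zero,
    not_false_eq_true, zero_pow] at hsum
  have h0 : ∫ t in (0 : ℝ)..T, (u t - v t) ^ 2 = 0 := by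
    have := hsum.unique hasSum_zero
    simpa [hT.ne'] using this
  refine ae_of_ae_restrict_Ioc_of_periodic hT
    (fun t => by rw [hu.periodic t, hv.periodic t]) ?_
  have hint := (hu.sub hv).intervalIntegrable_sq hT 0 T
  rw [intervalIntegral.integral_of_le hT.le, integral_eq_zero_iff_of_nonneg
    (fun t => sq_nonneg _) hint.1] at h0
  filter_upwards [h0] with t ht
  simpa [sub_eq_zero] using ht

/-- Riesz–Fischer for real functions: a square summable Hermitian sequence is the sequence of
Fourier coefficients of a real function. -/
theorem exists_memL2Per_perCoeff_eq (hTω : ω * T = 2 * Real.pi) (hT : 0 < T) (c : ℤ → ℂ)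
    (hc : Summable fun k => ‖c k‖ ^ 2) (hsymm : ∀ k, c (-k) = (starRingEnd ℂ) (c k)) :
    ∃ v, MemL2Per T v ∧ ∀ k, perCoeff ω T v k = c k := by
  have : Fact (0 < T) := ⟨hT⟩
  have hmem : Memℓp c 2 := by
    rw [memℓp_gen_iff (by norm_num)]
    simpa using hc
  let cl : lp (fun _ : ℤ => ℂ) 2 := ⟨c, hmem⟩
  let W := (fourierBasis (T := T)).repr.symm cl
  have hW : ∀ k, fourierCoeff W k = c k := fun k => by
    rw [← fourierBasis_repr, LinearIsometryEquiv.apply_symm_apply]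
  have hmp := AddCircle.measurePreserving_mk T 0
  rw [zero_add] at hmp
  have hvol : MemLp (W : AddCircle T → ℂ) 2 volume := by
    rw [AddCircle.volume_eq_smul_haarAddCircle]
    exact (Lp.memLp W).smul_measure ENNReal.ofReal_ne_top
  have hWm : MemLp (fun t : ℝ => W (t : AddCircle T)) 2 (volume.restrict (Set.Ioc 0 T)) :=
    hvol.comp_measurePreserving hmp
  have hv : MemL2Per T (fun t : ℝ => (W (t : AddCircle T)).re) := by
    refine ⟨fun t => ?_, hWm.re⟩
    simp only [AddCircle.coe_add_period]
  refine ⟨_, hv, fun k => ?_⟩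
  have hint : ∀ k : ℤ, IntervalIntegrable
      (fun t : ℝ => Complex.exp (-(k * ω * t) * Complex.I) * W (t : AddCircle T)) volume 0 T := by
    intro k
    refine IntervalIntegrable.continuousOn_mul ?_ (by fun_prop)
    rw [intervalIntegrable_iff_integrableOn_Ioc_of_le hT.le]
    exact hWm.integrable (by norm_num)
  have hcoef : ∀ k : ℤ, (T⁻¹ : ℂ) * ∫ t in (0 : ℝ)..T,
      Complex.exp (-(k * ω * t) * Complex.I) * W (t : AddCircle T) = c k := by
    intro k
    rw [← hW, fourierCoeff_eq_intervalIntegral _ _ 0, zero_add]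
    simp only [fourier_neg_eq_exp hTω hT]
    simp
  have hconj : ∫ t in (0 : ℝ)..T, (starRingEnd ℂ)
      (Complex.exp (-((-k : ℤ) * ω * t) * Complex.I) * W (t : AddCircle T)) =
      (starRingEnd ℂ) (∫ t in (0 : ℝ)..T,
        Complex.exp (-((-k : ℤ) * ω * t) * Complex.I) * W (t : AddCircle T)) :=
    intervalIntegral.intervalIntegral_conj
  have hpt : ∀ t : ℝ, Complex.exp (-(k * ω * t) * Complex.I) * ((W (t : AddCircle T)).re : ℂ) =
      2⁻¹ * (Complex.exp (-(k * ω * t) * Complex.I) * W (t : AddCircle T)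
        + (starRingEnd ℂ)
      (Complex.exp (-((-k : ℤ) * ω * t) * Complex.I) * W (t : AddCircle T))) := by
    intro t
    rw [map_mul, ← Complex.exp_conj, Complex.re_eq_add_conj]
    simp
    ring
  have hint' : IntervalIntegrable (fun t : ℝ => (starRingEnd ℂ)
      (Complex.exp (-((-k : ℤ) * ω * t) * Complex.I) * W (t : AddCircle T))) volume 0 T := by
    have := hint (-k)
    rw [intervalIntegrable_iff] at this ⊢
    exact (Complex.conjCLE.toContinuousLinearMap).integrable_comp this
  unfold perCoeff
  simp only [hpt]
  rw [intervalIntegral.integral_const_mul, intervalIntegral.integral_add (hint k) hint', hconj]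
  have e1 := hcoef k
  have e2 := congrArg (starRingEnd ℂ) (hcoef (-k))
  rw [map_mul, map_inv₀, Complex.conj_ofReal, hsymm, Complex.conj_conj] at e2
  linear_combination (2⁻¹ : ℂ) * e1 + (2⁻¹ : ℂ) * e2

/-- A Hermitian sequence `c` with `∑ (k ω)² |c k|² < ∞` is the sequence of Fourier coefficients of
an element of `H^1_♯`. -/
theorem exists_memH1Per_perCoeff_eq (hTω : ω * T = 2 * Real.pi) (hT : 0 < T) (c : ℤ → ℂ)
    (hc : Summable fun k : ℤ => (k * ω) ^ 2 * ‖c k‖ ^ 2)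
    (hsymm : ∀ k, c (-k) = (starRingEnd ℂ) (c k)) :
    ∃ y, MemH1Per T y ∧ ∀ k, perCoeff ω T y k = c k := by
  have hω : ω ≠ 0 := by
    rintro rfl
    simp [Real.pi_ne_zero] at hTω
  obtain ⟨v, hv, hvc⟩ := exists_memL2Per_perCoeff_eq hTω hT (fun k => k * ω * Complex.I * c k)
    (by
      refine hc.congr fun k => ?_
      simp [mul_pow])
    (by
      intro k
      simp [hsymm])
  have hmean : ∫ t in (0 : ℝ)..T, v t = 0 := by
    have h0 := hvc 0
    unfold perCoeff at h0
    simp only [Int.cast_zero, zero_mul, neg_zero, Complex.exp_zero, one_mul,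
      intervalIntegral.integral_ofReal] at h0
    have hT' : (T : ℂ) ≠ 0 := by exact_mod_cast hT.ne'
    have := (mul_eq_zero.1 h0).resolve_left (inv_ne_zero hT')
    exact_mod_cast this
  obtain ⟨hw, -⟩ := MemH1Per.of_integral hT hv hmean 0
  -- the additive constant that makes the mean of the primitive equal to `c 0`
  obtain ⟨hY, hYd⟩ := MemH1Per.of_integral hT hv hmean
    ((c 0).re - (perCoeff ω T (fun t => 0 + ∫ x in (0 : ℝ)..t, v x) 0).re)
  refine ⟨_, hY, fun k => ?_⟩
  rcases eq_or_ne k 0 with rfl | hk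
  · have hre : ∀ a : ℂ, a = (starRingEnd ℂ) a → (a.re : ℂ) = a := fun a ha =>
      Complex.conj_eq_iff_re.1 ha.symm
    have h1 : ((c 0).re : ℂ) = c 0 := hre _ (by simpa using hsymm 0)
    have h2 := perCoeff_neg (ω := ω) (T := T) (fun t => 0 + ∫ x in (0 : ℝ)..t, v x) 0
    rw [neg_zero] at h2
    replace h2 := hre _ h2
    have hconst : ∀ C : ℝ, perCoeff ω T (fun _ => C) 0 = C := by
      intro C
      have hT' : (T : ℂ) ≠ 0 := by exact_mod_cast hT.ne'
      simp [perCoeff, hT']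
    have hadd := perCoeff_add (ω := ω) hT
      (MemL2Per.of_continuous (T := T) (u := fun _ => (c 0).re -
        (perCoeff ω T (fun t => 0 + ∫ x in (0 : ℝ)..t, v x) 0).re) (fun _ => rfl) continuous_const)
      hw.memL2Per 0
    rw [hconst, Complex.ofReal_sub, h1, h2, sub_add_cancel] at hadd
    simpa using hadd
  · have h1 := hY.perCoeff_deriv hTω hT k
    rw [perCoeff_congr_ae hYd, hvc] at h1
    have hne : (k : ℂ) * ω * Complex.I ≠ 0 :=
      mul_ne_zero (mul_ne_zero (by exact_mod_cast hk) (by exact_mod_cast hω)) Complex.I_ne_zero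
    exact (mul_left_cancel₀ hne h1).symm

end

/-! ### The symbol of the linearised equation -/

/-- The Fourier symbol of the operator `y ↦ y' + c y'(· - 1) + a y + b y(· - 1)` on functions of
angular frequency `ω`. -/
noncomputable def nddeSymbol (c a b ω : ℝ) (k : ℤ) : ℂ :=
  k * ω * Complex.I + a + Complex.exp (-(k * ω) * Complex.I) * (c * (k * ω * Complex.I) + b)

section

variable {c a b ω : ℝ}

theorem nddeSymbol_neg (k : ℤ) :
    nddeSymbol c a b ω (-k) = (starRingEnd ℂ) (nddeSymbol c a b ω k) := by
  unfold nddeSymbol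
  simp only [map_add, map_mul, Complex.conj_ofReal, Complex.conj_I, ← Complex.exp_conj]
  simp

/-- The symbol has no zeros: at a zero, the moduli of `i k ω + a` and `± i k ω + b` would agree. -/
theorem nddeSymbol_ne_zero (hc : c = 1 ∨ c = -1) (hab : |b| < a) (k : ℤ) :
    nddeSymbol c a b ω k ≠ 0 := by
  intro h
  have h1 : (k * ω * Complex.I + a : ℂ) =
      -(Complex.exp (-(k * ω) * Complex.I) * (c * (k * ω * Complex.I) + b)) :=
    eq_neg_of_add_eq_zero_left (by rw [← h, nddeSymbol])
  have h2 := congrArg (fun z => ‖z‖ ^ 2) h1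
  have hE : ‖Complex.exp (-(k * ω) * Complex.I)‖ = 1 := by
    have := Complex.norm_exp_ofReal_mul_I (-(k * ω))
    push_cast at this
    exact this
  simp only [norm_neg, norm_mul, hE, one_mul] at h2
  rw [← Complex.normSq_eq_norm_sq, ← Complex.normSq_eq_norm_sq] at h2
  simp [Complex.normSq_apply] at h2
  have h3 : b ^ 2 < a ^ 2 := sq_lt_sq' (by linarith [abs_lt.1 hab]) (abs_lt.1 hab).2
  have hc2 : c * c = 1 := by rcases hc with rfl | rfl <;> norm_num
  have h4 : c * (k * ω) * (c * (k * ω)) = k * ω * (k * ω) := by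
    linear_combination (k * ω) ^ 2 * hc2
  nlinarith

theorem exp_rootFreq (hc : c = 1 ∨ c = -1) (n : ℤ) :
    Complex.exp (-(rootFreq c n) * Complex.I) = -c := by
  have h1 : Complex.exp ((-n : ℤ) * (2 * Real.pi * Complex.I)) = 1 :=
    Complex.exp_int_mul_two_pi_mul_I _
  rcases hc with rfl | rfl
  · have : (-(rootFreq 1 n) * Complex.I : ℂ) =
        (-n : ℤ) * (2 * Real.pi * Complex.I) - Real.pi * Complex.I := by
      simp only [rootFreq]
      push_cast
      ring
    rw [this, Complex.exp_sub, h1, Complex.exp_pi_mul_I]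
    norm_num
  · have : (-(rootFreq (-1) n) * Complex.I : ℂ) = (-n : ℤ) * (2 * Real.pi * Complex.I) := by
      simp only [rootFreq]
      push_cast
      ring
    rw [this, h1]
    norm_num

/-- The symbol in terms of the distance from a root frequency. -/
theorem nddeSymbol_eq (hc : c = 1 ∨ c = -1) (k n : ℤ) {δ : ℝ}
    (hδ : δ = k * ω - rootFreq c n) :
    nddeSymbol c a b ω k = -(k * ω * Complex.I) * (Complex.exp (-δ * Complex.I) - 1)
      + a - c * b * Complex.exp (-δ * Complex.I) := by
  have h : Complex.exp (-(k * ω) * Complex.I) = -c * Complex.exp (-δ * Complex.I) := by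
    rw [← exp_rootFreq hc n, ← Complex.exp_add]
    congr 1
    rw [hδ]
    push_cast
    ring
  have hc2 : (c * c : ℂ) = 1 := by rcases hc with rfl | rfl <;> norm_num
  rw [nddeSymbol, h]
  linear_combination (-(k * ω * Complex.I) * Complex.exp (-δ * Complex.I)) * hc2

theorem exists_abs_sub_rootFreq_le (c x : ℝ) : ∃ n : ℤ, |x - rootFreq c n| ≤ Real.pi := by
  refine ⟨round ((x - (1 + c) / 2 * Real.pi) / (2 * Real.pi)), ?_⟩
  have h := abs_sub_round ((x - (1 + c) / 2 * Real.pi) / (2 * Real.pi))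
  have hpi := Real.pi_pos
  have e : x - rootFreq c (round ((x - (1 + c) / 2 * Real.pi) / (2 * Real.pi))) =
      (2 * Real.pi) * ((x - (1 + c) / 2 * Real.pi) / (2 * Real.pi) -
        round ((x - (1 + c) / 2 * Real.pi) / (2 * Real.pi))) := by
    rw [mul_sub, mul_div_cancel₀ _ (by positivity), rootFreq]
    ring
  rw [e, abs_mul, abs_of_pos (by positivity)]
  nlinarith

theorem norm_exp_sub_one_eq (δ : ℝ) :
    ‖Complex.exp (-δ * Complex.I) - 1‖ = 2 * |Real.sin (δ / 2)| := by
  have := Complex.norm_exp_I_mul_ofReal_sub_one (-δ)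
  rw [mul_comm] at this
  push_cast at this
  rw [this, neg_div, Real.sin_neg]
  simp

/-- A small value of the symbol forces the distance `δ` to the nearest root frequency to be
`O(1 / |k|)`. -/
theorem abs_mul_abs_le_of_norm_nddeSymbol_le (hc : c = 1 ∨ c = -1) (k n : ℤ) {δ : ℝ}
    (hδ : δ = k * ω - rootFreq c n) (hδπ : |δ| ≤ Real.pi) (hsmall : ‖nddeSymbol c a b ω k‖ ≤ 1) :
    |k * ω| * |δ| ≤ Real.pi / 2 * (1 + |a| + |b|) := by
  have hpi := Real.pi_pos
  have hE : ‖Complex.exp (-δ * Complex.I)‖ = 1 := by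
    have := Complex.norm_exp_ofReal_mul_I (-δ)
    push_cast at this
    exact this
  have hcn : ‖(c : ℂ)‖ = 1 := by rcases hc with rfl | rfl <;> simp
  have h1 : (k * ω * Complex.I) * (Complex.exp (-δ * Complex.I) - 1) =
      a - c * b * Complex.exp (-δ * Complex.I) - nddeSymbol c a b ω k := by
    rw [nddeSymbol_eq hc k n hδ]
    ring
  have h2 : |k * ω| * (2 * |Real.sin (δ / 2)|) ≤ |a| + |b| + 1 := by
    have := congrArg norm h1
    rw [norm_mul, norm_exp_sub_one_eq] at this
    have e : ‖(k * ω * Complex.I : ℂ)‖ = |k * ω| := by simp [abs_mul]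
    rw [e] at this
    rw [this]
    refine (norm_sub_le _ _).trans (add_le_add ((norm_sub_le _ _).trans ?_) hsmall)
    rw [norm_mul, norm_mul, hE, hcn, one_mul, mul_one, Complex.norm_real, Complex.norm_real,
      Real.norm_eq_abs, Real.norm_eq_abs]
  have h3 : 2 / Real.pi * |δ / 2| ≤ |Real.sin (δ / 2)| := by
    refine Real.mul_abs_le_abs_sin ?_
    rw [abs_div, abs_two]
    linarith
  have h4 : |δ| = Real.pi / 2 * (2 * (2 / Real.pi * |δ / 2|)) := by
    rw [abs_div, abs_two]
    field
  calc |k * ω| * |δ| ≤ |k * ω| * (Real.pi / 2 * (2 * |Real.sin (δ / 2)|)) := by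
        rw [h4]
        gcongr
    _ = Real.pi / 2 * (|k * ω| * (2 * |Real.sin (δ / 2)|)) := by ring
    _ ≤ Real.pi / 2 * (1 + |a| + |b|) := by
        refine mul_le_mul_of_nonneg_left ?_ (by positivity)
        linarith

/-- Near a root frequency the symbol is `d - Ω δ` up to an error that is `O(|δ|)` as long as `k δ`
is bounded. -/
theorem norm_nddeSymbol_sub_le (hc : c = 1 ∨ c = -1) (k n : ℤ) {δ : ℝ}
    (hδ : δ = k * ω - rootFreq c n) (hδ1 : |δ| ≤ 1) :
    ‖nddeSymbol c a b ω k - ((a - c * b - rootFreq c n * δ : ℝ) : ℂ)‖ ≤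
      (1 + |k * ω| * |δ| + |b|) * |δ| := by
  have hcn : ‖(c : ℂ)‖ = 1 := by rcases hc with rfl | rfl <;> simp
  have hδn : ‖(-δ * Complex.I : ℂ)‖ = |δ| := by simp
  have h1 : nddeSymbol c a b ω k - ((a - c * b - rootFreq c n * δ : ℝ) : ℂ) =
      -(δ : ℂ) ^ 2 - (k * ω * Complex.I) * (Complex.exp (-δ * Complex.I) - 1 - (-δ * Complex.I))
        - c * b * (Complex.exp (-δ * Complex.I) - 1) := by
    have hx : (rootFreq c n : ℂ) = k * ω - δ := by
      rw [hδ]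
      push_cast
      ring
    rw [nddeSymbol_eq hc k n hδ]
    push_cast
    rw [hx]
    linear_combination ((k * ω * δ) : ℂ) * Complex.I_sq
  have h2 : ‖Complex.exp (-δ * Complex.I) - 1 - (-δ * Complex.I)‖ ≤ |δ| ^ 2 := by
    have := Complex.norm_exp_sub_one_sub_id_le (x := -δ * Complex.I) (by rw [hδn]; exact hδ1)
    rwa [hδn] at this
  have h3 : ‖Complex.exp (-δ * Complex.I) - 1‖ ≤ |δ| := by
    rw [norm_exp_sub_one_eq]
    have := Real.abs_sin_le_abs (x := δ / 2)
    rw [abs_div, abs_two] at this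
    linarith
  have e : ‖(k * ω * Complex.I : ℂ)‖ = |k * ω| := by simp [abs_mul]
  have e2 : ‖(c * b : ℂ)‖ = |b| := by rw [norm_mul, hcn]; simp
  rw [h1]
  calc _ ≤ ‖-(δ : ℂ) ^ 2‖ + ‖(k * ω * Complex.I) *
          (Complex.exp (-δ * Complex.I) - 1 - (-δ * Complex.I))‖
          + ‖(c * b : ℂ) * (Complex.exp (-δ * Complex.I) - 1)‖ :=
        (norm_sub_le _ _).trans (add_le_add_left (norm_sub_le _ _) _)
    _ ≤ |δ| ^ 2 + |k * ω| * |δ| ^ 2 + |b| * |δ| := by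
        rw [norm_mul (k * ω * Complex.I : ℂ), norm_mul (c * b : ℂ), e, e2]
        gcongr
        simp
    _ ≤ (1 + |k * ω| * |δ| + |b|) * |δ| := by nlinarith [abs_nonneg δ]

/-- Under the Diophantine condition the symbol is bounded away from zero. -/
theorem exists_le_norm_nddeSymbol (hc : c = 1 ∨ c = -1) (hab : |b| < a) (hω : 0 < ω)
    (φ : ℤ → ℤ)
    (hφ : ∀ k n : ℤ, |(k : ℝ) * ω - rootFreq c (φ k)| ≤ |(k : ℝ) * ω - rootFreq c n|)
    (hdioph : 0 < Filter.liminf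
      (fun k : ℤ => ((|a - c * b - rootFreq c (φ k) * ((k : ℝ) * ω - rootFreq c (φ k))| : ℝ) :
        EReal)) Filter.cofinite) :
    ∃ m : ℝ, 0 < m ∧ ∀ k : ℤ, m ≤ ‖nddeSymbol c a b ω k‖ := by
  obtain ⟨l, hl0, hl⟩ := EReal.lt_iff_exists_real_btwn.1 hdioph
  have hl0' : 0 < l := by exact_mod_cast hl0
  have hev := Filter.eventually_lt_of_lt_liminf hl
  set M := Real.pi / 2 * (1 + |a| + |b|) with hM
  have hM0 : 0 < M := by have := Real.pi_pos; positivity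
  set X := M + 2 * (1 + M + |b|) * M / l with hX
  have hX0 : 0 < X := by positivity
  have hlarge : ∀ᶠ k : ℤ in Filter.cofinite, X ≤ |(k : ℝ) * ω| := by
    have := (tendsto_norm_cocompact_atTop.comp Int.tendsto_coe_cofinite).eventually_ge_atTop (X / ω)
    filter_upwards [this] with k hk
    rw [abs_mul, abs_of_pos hω]
    exact (div_le_iff₀ hω).1 hk
  have hmain : ∀ᶠ k : ℤ in Filter.cofinite, min 1 (l / 2) ≤ ‖nddeSymbol c a b ω k‖ := by
    filter_upwards [hev, hlarge] with k hk hkX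
    have hk' : l < |a - c * b - rootFreq c (φ k) * ((k : ℝ) * ω - rootFreq c (φ k))| := by
      exact_mod_cast hk
    by_contra! hcon
    have hs1 := (lt_min_iff.1 hcon).1
    have hs2 := (lt_min_iff.1 hcon).2
    set δ := (k : ℝ) * ω - rootFreq c (φ k) with hδ
    have hδπ : |δ| ≤ Real.pi := by
      obtain ⟨n, hn⟩ := exists_abs_sub_rootFreq_le c ((k : ℝ) * ω)
      exact (hφ k n).trans hn
    have h1 := abs_mul_abs_le_of_norm_nddeSymbol_le hc k (φ k) hδ hδπ hs1.le
    rw [← hM] at h1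
    have h2 : X * |δ| ≤ M := (mul_le_mul_of_nonneg_right hkX (abs_nonneg _)).trans h1
    have hMX : M ≤ X := by rw [hX]; have : 0 ≤ 2 * (1 + M + |b|) * M / l := by positivity
                           linarith
    have hδ1 : |δ| ≤ 1 := by
      by_contra! h
      nlinarith
    have h3 := norm_nddeSymbol_sub_le (a := a) (b := b) hc k (φ k) hδ hδ1
    have h4 : (1 + |k * ω| * |δ| + |b|) * |δ| ≤ l / 2 := by
      have : (1 + |k * ω| * |δ| + |b|) * |δ| ≤ (1 + M + |b|) * |δ| := by gcongr
      refine this.trans ?_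
      have h5 : (2 * (1 + M + |b|) * M / l) * |δ| ≤ M := by
        refine (mul_le_mul_of_nonneg_right ?_ (abs_nonneg _)).trans h2
        rw [hX]
        linarith
      have h6 : (2 * (1 + M + |b|) / l) * |δ| ≤ 1 := by
        refine le_of_mul_le_mul_left ?_ hM0
        calc M * ((2 * (1 + M + |b|) / l) * |δ|) = (2 * (1 + M + |b|) * M / l) * |δ| := by ring
          _ ≤ M * 1 := by linarith
      rw [div_mul_eq_mul_div, div_le_one hl0'] at h6
      linarith
    have h5 := norm_sub_norm_le ((a - c * b - rootFreq c (φ k) * δ : ℝ) : ℂ)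
      (nddeSymbol c a b ω k)
    rw [norm_sub_rev, Complex.norm_real, Real.norm_eq_abs] at h5
    linarith
  set μ := min 1 (l / 2) with hμ
  have hμ0 : 0 < μ := lt_min one_pos (by linarith)
  have hfin : {k : ℤ | ¬ μ ≤ ‖nddeSymbol c a b ω k‖}.Finite := hmain
  rcases Set.eq_empty_or_nonempty {k : ℤ | ¬ μ ≤ ‖nddeSymbol c a b ω k‖} with he | hne
  · refine ⟨μ, hμ0, fun k => ?_⟩
    by_contra h
    exact (he ▸ h : k ∈ (∅ : Set ℤ))
  · obtain ⟨k₀, -, hk₀⟩ := Set.exists_min_image _ (fun k => ‖nddeSymbol c a b ω k‖) hfin hne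
    refine ⟨min μ ‖nddeSymbol c a b ω k₀‖,
      lt_min hμ0 (norm_pos_iff.2 (nddeSymbol_ne_zero hc hab k₀)), fun k => ?_⟩
    by_cases h : μ ≤ ‖nddeSymbol c a b ω k‖
    · exact (min_le_left _ _).trans h
    · exact (min_le_right _ _).trans (hk₀ k h)

end

/-! ### The linearised equation -/

/-- The linear neutral delay operator `y' + c y'(· - 1) + a y + b y(· - 1)`. -/
noncomputable def nddeLinear (c a b : ℝ) (y : ℝ → ℝ) (t : ℝ) : ℝ :=
  deriv y t + c * deriv y (t - 1) + a * y t + b * y (t - 1)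

section

variable {c a b ω T m : ℝ} {y h : ℝ → ℝ}

theorem MemH1Per.memL2Per_nddeLinear (hT : 0 < T) (hy : MemH1Per T y) :
    MemL2Per T (nddeLinear c a b y) :=
  ((hy.memL2Per_deriv.add ((hy.memL2Per_deriv.comp_sub hT 1).const_mul c)).add
    (hy.memL2Per.const_mul a)).add ((hy.memL2Per.comp_sub hT 1).const_mul b)

theorem MemH1Per.perCoeff_nddeLinear (hTω : ω * T = 2 * Real.pi) (hT : 0 < T) (hy : MemH1Per T y)
    (k : ℤ) :
    perCoeff ω T (nddeLinear c a b y) k = nddeSymbol c a b ω k * perCoeff ω T y k := by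
  have hd := hy.memL2Per_deriv
  have hd1 := (hd.comp_sub hT 1).const_mul c
  have h0 := hy.memL2Per.const_mul a
  have h1 := (hy.memL2Per.comp_sub hT 1).const_mul b
  unfold nddeLinear
  rw [perCoeff_add hT ((hd.add hd1).add h0) h1, perCoeff_add hT (hd.add hd1) h0,
    perCoeff_add hT hd hd1, perCoeff_const_mul, perCoeff_const_mul, perCoeff_const_mul,
    perCoeff_comp_sub hTω hd.periodic, perCoeff_comp_sub hTω hy.periodic,
    hy.perCoeff_deriv hTω hT, nddeSymbol]
  push_cast
  ring_nf

/-- The `L²` stability estimate for the linear operator. -/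
theorem MemH1Per.sq_mul_integral_sq_le (hTω : ω * T = 2 * Real.pi) (hT : 0 < T) (hm : 0 < m)
    (hσ : ∀ k, m ≤ ‖nddeSymbol c a b ω k‖) (hy : MemH1Per T y) :
    m ^ 2 * ∫ t in (0 : ℝ)..T, y t ^ 2 ≤ ∫ t in (0 : ℝ)..T, nddeLinear c a b y t ^ 2 := by
  have h1 := (hy.memL2Per.hasSum_sq_perCoeff hTω hT).mul_left (m ^ 2)
  have h2 := (hy.memL2Per_nddeLinear (c := c) (a := a) (b := b) hT).hasSum_sq_perCoeff hTω hT
  have := hasSum_le (fun k => ?_) h1 h2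
  · rw [mul_left_comm] at this
    exact le_of_mul_le_mul_left this (inv_pos.2 hT)
  · rw [hy.perCoeff_nddeLinear hTω hT, norm_mul, mul_pow]
    gcongr
    exact hσ k

/-- The linear equation is solvable in `H^1_♯`, without gain or loss of derivatives. -/
theorem exists_nddeLinear_ae_eq (hTω : ω * T = 2 * Real.pi) (hT : 0 < T) (hm : 0 < m)
    (hσ : ∀ k, m ≤ ‖nddeSymbol c a b ω k‖) (hh : MemH1Per T h) :
    ∃ z, MemH1Per T z ∧ nddeLinear c a b z =ᵐ[volume] h ∧
      m ^ 2 * ∫ t in (0 : ℝ)..T, z t ^ 2 ≤ ∫ t in (0 : ℝ)..T, h t ^ 2 ∧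
      m ^ 2 * ∫ t in (0 : ℝ)..T, deriv z t ^ 2 ≤ ∫ t in (0 : ℝ)..T, deriv h t ^ 2 := by
  have hne : ∀ k, nddeSymbol c a b ω k ≠ 0 := fun k =>
    norm_pos_iff.1 (hm.trans_le (hσ k))
  have hle : ∀ (k : ℤ), m ^ 2 * (((k : ℝ) * ω) ^ 2 *
      ‖perCoeff ω T h k / nddeSymbol c a b ω k‖ ^ 2) ≤ ‖perCoeff ω T (deriv h) k‖ ^ 2 := by
    intro k
    rw [hh.perCoeff_deriv hTω hT, norm_div, norm_mul]
    have e : ‖(k * ω * Complex.I : ℂ)‖ ^ 2 = ((k : ℝ) * ω) ^ 2 := by simp [mul_pow]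
    rw [mul_pow ‖_‖, e, mul_left_comm]
    refine mul_le_mul_of_nonneg_left ?_ (sq_nonneg _)
    rw [← mul_pow]
    refine pow_le_pow_left₀ (by positivity) ?_ 2
    have hs := hm.trans_le (hσ k)
    rw [mul_div_assoc', div_le_iff₀ hs, mul_comm]
    exact mul_le_mul_of_nonneg_left (hσ k) (norm_nonneg _)
  have hsum' := hh.memL2Per_deriv.hasSum_sq_perCoeff hTω hT
  obtain ⟨z, hz, hzc⟩ := exists_memH1Per_perCoeff_eq hTω hT
    (fun k => perCoeff ω T h k / nddeSymbol c a b ω k)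
    (by
      have := Summable.of_nonneg_of_le (fun k => by positivity) hle hsum'.summable
      exact (summable_mul_left_iff (by positivity)).1 this)
    (fun k => by simp only [perCoeff_neg, nddeSymbol_neg, map_div₀])
  have hae : nddeLinear c a b z =ᵐ[volume] h := by
    refine (hz.memL2Per_nddeLinear hT).ae_eq_of_perCoeff_eq hTω hT hh.memL2Per fun k => ?_
    rw [hz.perCoeff_nddeLinear hTω hT, hzc, mul_div_cancel₀ _ (hne k)]
  refine ⟨z, hz, hae, ?_, ?_⟩
  · refine (hz.sq_mul_integral_sq_le hTω hT hm hσ).trans_eq ?_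
    refine intervalIntegral.integral_congr_ae ?_
    filter_upwards [hae] with t ht _
    rw [ht]
  · have h1 := (hz.memL2Per_deriv.hasSum_sq_perCoeff hTω hT).mul_left (m ^ 2)
    have := hasSum_le (fun k => ?_) h1 hsum'
    · rw [mul_left_comm] at this
      exact le_of_mul_le_mul_left this (inv_pos.2 hT)
    · refine le_trans (le_of_eq ?_) (hle k)
      rw [hz.perCoeff_deriv hTω hT, hzc]
      simp [mul_pow]

end

/-! ### Remainder terms -/

/-- The square of the norm of `H^1_♯`, as a sum of two integrals. -/
noncomputable def h1PerSq (T : ℝ) (y : ℝ → ℝ) : ℝ :=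
  (∫ t in (0 : ℝ)..T, y t ^ 2) + ∫ t in (0 : ℝ)..T, deriv y t ^ 2

section

variable {T η ρ : ℝ} {p q y z s : ℝ → ℝ}

theorem h1PerSq_nonneg (hT : 0 < T) (y : ℝ → ℝ) : 0 ≤ h1PerSq T y :=
  add_nonneg (intervalIntegral.integral_nonneg hT.le fun _ _ => sq_nonneg _)
    (intervalIntegral.integral_nonneg hT.le fun _ _ => sq_nonneg _)

theorem MemH1Per.h1PerNorm_le_iff (hT : 0 < T) (hy : MemH1Per T y) {R : ℝ} (hR : 0 ≤ R) :
    h1PerNorm T y ≤ R ↔ h1PerSq T y ≤ R ^ 2 := by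
  rw [h1PerNorm, Real.sqrt_le_left hR, h1PerSq,
    intervalIntegral.integral_add (hy.memL2Per.intervalIntegrable_sq hT 0 T)
      (hy.memL2Per_deriv.intervalIntegrable_sq hT 0 T)]

theorem MemH1Per.sq_le_mul_h1PerSq (hT : 0 < T) (hy : MemH1Per T y) (t : ℝ) :
    y t ^ 2 ≤ (1 / T + 1) * h1PerSq T y := by
  have h := hy.sq_le hT one_pos t
  have hd : 0 ≤ ∫ x in (0 : ℝ)..T, deriv y x ^ 2 :=
    intervalIntegral.integral_nonneg hT.le fun _ _ => sq_nonneg _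
  have := mul_nonneg (one_div_pos.2 hT).le hd
  rw [h1PerSq]
  nlinarith

theorem MemL2Per.integral_sq_mono (hT : 0 < T) {u v : ℝ → ℝ} {C : ℝ} (hu : MemL2Per T u)
    (hv : MemL2Per T v) (h : ∀ᵐ t, u t ^ 2 ≤ C * v t ^ 2) :
    ∫ t in (0 : ℝ)..T, u t ^ 2 ≤ C * ∫ t in (0 : ℝ)..T, v t ^ 2 := by
  rw [← intervalIntegral.integral_const_mul]
  exact intervalIntegral.integral_mono_ae hT.le (hu.intervalIntegrable_sq hT 0 T)
    ((hv.intervalIntegrable_sq hT 0 T).const_mul C) h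

/-- If `u² ≤ C v²` and `w² ≤ C v²` pointwise, adding to `u` a translate of `w` costs at most a
factor four. -/
theorem MemL2Per.integral_sq_add_comp_sub_le (hT : 0 < T) {u v w : ℝ → ℝ} {C : ℝ}
    (hu : MemL2Per T u) (hw : MemL2Per T w) (hv : MemL2Per T v)
    (h : ∀ᵐ t, u t ^ 2 ≤ C * v t ^ 2) (h' : ∀ᵐ t, w t ^ 2 ≤ C * v t ^ 2) (τ : ℝ) :
    ∫ t in (0 : ℝ)..T, (u t + w (t - τ)) ^ 2 ≤ 4 * C * ∫ t in (0 : ℝ)..T, v t ^ 2 := by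
  have hws := hw.comp_sub hT τ
  have hsq : Function.Periodic (fun t => w t ^ 2) T := fun t => by simp only [hw.periodic t]
  have e := intervalIntegral_comp_sub_of_periodic hsq τ
  have h1 := hu.integral_sq_mono hT hv h
  have h2 := hw.integral_sq_mono hT hv h'
  calc _ ≤ ∫ t in (0 : ℝ)..T, (2 * u t ^ 2 + 2 * w (t - τ) ^ 2) := by
        refine intervalIntegral.integral_mono hT.le ((hu.add hws).intervalIntegrable_sq hT 0 T)
          (((hu.intervalIntegrable_sq hT 0 T).const_mul 2).add
            ((hws.intervalIntegrable_sq hT 0 T).const_mul 2)) fun t => ?_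
        simp only
        nlinarith [sq_nonneg (u t - w (t - τ))]
    _ = 2 * (∫ t in (0 : ℝ)..T, u t ^ 2) + 2 * ∫ t in (0 : ℝ)..T, w t ^ 2 := by
        rw [intervalIntegral.integral_add ((hu.intervalIntegrable_sq hT 0 T).const_mul 2)
          ((hws.intervalIntegrable_sq hT 0 T).const_mul 2), intervalIntegral.integral_const_mul,
          intervalIntegral.integral_const_mul, e]
    _ ≤ _ := by linarith

theorem abs_sub_le_of_abs_deriv_le (hp : ContDiff ℝ 1 p) (hη : ∀ x, |x| ≤ ρ → |deriv p x| ≤ η)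
    {x x' : ℝ} (hx : |x| ≤ ρ) (hx' : |x'| ≤ ρ) : |p x - p x'| ≤ η * |x - x'| := by
  have := (convex_Icc (-ρ) ρ).norm_image_sub_le_of_norm_deriv_le (f := p) (C := η)
    (fun x _ => hp.differentiable one_ne_zero x) (fun x hx => hη x (abs_le.2 hx))
    (abs_le.1 hx') (abs_le.1 hx)
  simpa only [Real.norm_eq_abs] using this

theorem sq_sub_le_of_abs_deriv_le (hp : ContDiff ℝ 1 p) (hη : ∀ x, |x| ≤ ρ → |deriv p x| ≤ η)
    {x x' : ℝ} (hx : |x| ≤ ρ) (hx' : |x'| ≤ ρ) : (p x - p x') ^ 2 ≤ η ^ 2 * (x - x') ^ 2 := by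
  have := pow_le_pow_left₀ (abs_nonneg _) (abs_sub_le_of_abs_deriv_le hp hη hx hx') 2
  rwa [mul_pow, sq_abs, sq_abs] at this

/-- The `L²` Lipschitz estimate for the nonlinearity `y ↦ p(y) + q(y(· - 1))`. -/
theorem MemH1Per.integral_sq_remainder_sub_le (hT : 0 < T) (hp : ContDiff ℝ 1 p)
    (hq : ContDiff ℝ 1 q) (hpη : ∀ x, |x| ≤ ρ → |deriv p x| ≤ η)
    (hqη : ∀ x, |x| ≤ ρ → |deriv q x| ≤ η) (hy : MemH1Per T y) (hz : MemH1Per T z)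
    (hyρ : ∀ t, |y t| ≤ ρ) (hzρ : ∀ t, |z t| ≤ ρ) :
    ∫ t in (0 : ℝ)..T, ((p (y t) + q (y (t - 1))) - (p (z t) + q (z (t - 1)))) ^ 2 ≤
      4 * η ^ 2 * ∫ t in (0 : ℝ)..T, (y t - z t) ^ 2 := by
  have := MemL2Per.integral_sq_add_comp_sub_le hT (u := fun t => p (y t) - p (z t))
    (w := fun t => q (y t) - q (z t)) (v := fun t => y t - z t) (C := η ^ 2)
    ((hy.comp hp).memL2Per.sub (hz.comp hp).memL2Per)
    ((hy.comp hq).memL2Per.sub (hz.comp hq).memL2Per) (hy.memL2Per.sub hz.memL2Per)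
    (.of_forall fun t => sq_sub_le_of_abs_deriv_le hp hpη (hyρ t) (hzρ t))
    (.of_forall fun t => sq_sub_le_of_abs_deriv_le hq hqη (hyρ t) (hzρ t)) 1
  refine le_trans (le_of_eq ?_) this
  refine intervalIntegral.integral_congr fun t _ => ?_
  ring

theorem MemH1Per.remainder (hT : 0 < T) (hp : ContDiff ℝ 1 p) (hq : ContDiff ℝ 1 q)
    (hy : MemH1Per T y) : MemH1Per T (fun t => p (y t) + q (y (t - 1))) :=
  (hy.comp hp).add ((hy.comp hq).comp_sub hT 1)

/-- The derivative of the nonlinearity is bounded linearly in `L²`. -/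
theorem MemH1Per.integral_sq_deriv_remainder_le (hT : 0 < T) (hp : ContDiff ℝ 1 p)
    (hq : ContDiff ℝ 1 q) (hpη : ∀ x, |x| ≤ ρ → |deriv p x| ≤ η)
    (hqη : ∀ x, |x| ≤ ρ → |deriv q x| ≤ η) (hy : MemH1Per T y) (hyρ : ∀ t, |y t| ≤ ρ) :
    ∫ t in (0 : ℝ)..T, deriv (fun t => p (y t) + q (y (t - 1))) t ^ 2 ≤
      4 * η ^ 2 * ∫ t in (0 : ℝ)..T, deriv y t ^ 2 := by
  have key : ∀ {r : ℝ → ℝ}, ContDiff ℝ 1 r → (∀ x, |x| ≤ ρ → |deriv r x| ≤ η) →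
      ∀ᵐ t, deriv (fun t => r (y t)) t ^ 2 ≤ η ^ 2 * deriv y t ^ 2 := by
    intro r hr hrη
    filter_upwards [hy.deriv_comp_ae hr] with t ht
    rw [ht, mul_pow]
    refine mul_le_mul_of_nonneg_right ?_ (sq_nonneg _)
    rw [← sq_abs (deriv r (y t))]
    exact pow_le_pow_left₀ (abs_nonneg _) (hrη _ (hyρ t)) 2
  have := MemL2Per.integral_sq_add_comp_sub_le hT (hy.comp hp).memL2Per_deriv
    (hy.comp hq).memL2Per_deriv hy.memL2Per_deriv (key hp hpη) (key hq hqη) 1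
  refine le_trans (le_of_eq ?_) this
  refine intervalIntegral.integral_congr_ae ?_
  filter_upwards [(hy.comp hp).deriv_add_ae ((hy.comp hq).comp_sub hT 1)] with t ht _
  rw [ht, deriv_comp_sub_const (f := fun t => q (y t))]

theorem MemL2Per.integral_sq_sub_le (hT : 0 < T) {u v : ℝ → ℝ} (hu : MemL2Per T u)
    (hv : MemL2Per T v) : ∫ t in (0 : ℝ)..T, (u t - v t) ^ 2 ≤
      2 * (∫ t in (0 : ℝ)..T, u t ^ 2) + 2 * ∫ t in (0 : ℝ)..T, v t ^ 2 := by
  rw [← intervalIntegral.integral_const_mul, ← intervalIntegral.integral_const_mul,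
    ← intervalIntegral.integral_add ((hu.intervalIntegrable_sq hT 0 T).const_mul 2)
      ((hv.intervalIntegrable_sq hT 0 T).const_mul 2)]
  refine intervalIntegral.integral_mono hT.le ((hu.sub hv).intervalIntegrable_sq hT 0 T)
    (((hu.intervalIntegrable_sq hT 0 T).const_mul 2).add
      ((hv.intervalIntegrable_sq hT 0 T).const_mul 2)) fun t => ?_
  simp only
  nlinarith [sq_nonneg (u t + v t)]

/-- The nonlinearity is small in the `H^1_♯` norm, although it is not Lipschitz for it. -/
theorem MemH1Per.h1PerSq_source_sub_remainder_le (hT : 0 < T) (hp : ContDiff ℝ 1 p)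
    (hq : ContDiff ℝ 1 q) (hp0 : p 0 = 0) (hq0 : q 0 = 0) (hρ : 0 ≤ ρ)
    (hpη : ∀ x, |x| ≤ ρ → |deriv p x| ≤ η) (hqη : ∀ x, |x| ≤ ρ → |deriv q x| ≤ η)
    (hs : MemH1Per T s) (hy : MemH1Per T y) (hyρ : ∀ t, |y t| ≤ ρ) :
    h1PerSq T (fun t => s t - (p (y t) + q (y (t - 1)))) ≤
      2 * h1PerSq T s + 8 * η ^ 2 * h1PerSq T y := by
  have hN := hy.remainder hT hp hq
  have h1 := hs.memL2Per.integral_sq_sub_le hT hN.memL2Per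
  have h2 := hs.memL2Per_deriv.integral_sq_sub_le hT hN.memL2Per_deriv
  have h0 : MemH1Per T (fun _ : ℝ => (0 : ℝ)) :=
    hy.comp (p := fun _ => 0) contDiff_const
  have h3 := hy.integral_sq_remainder_sub_le hT hp hq hpη hqη h0 hyρ (fun _ => by simpa using hρ)
  simp only [hp0, hq0, add_zero, sub_zero] at h3
  have h4 := hy.integral_sq_deriv_remainder_le hT hp hq hpη hqη hyρ
  have h5 : ∫ t in (0 : ℝ)..T, deriv (fun t => s t - (p (y t) + q (y (t - 1)))) t ^ 2 =
      ∫ t in (0 : ℝ)..T, (deriv s t - deriv (fun t => p (y t) + q (y (t - 1))) t) ^ 2 := by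
    refine intervalIntegral.integral_congr_ae ?_
    filter_upwards [hs.deriv_sub_ae hN] with t ht _
    rw [ht]
  simp only [h1PerSq]
  rw [h5]
  linarith

theorem MemH1Per.nddeLinear_sub_ae (c a b : ℝ) (hy : MemH1Per T y) (hz : MemH1Per T z) :
    nddeLinear c a b (fun t => y t - z t) =ᵐ[volume]
      fun t => nddeLinear c a b y t - nddeLinear c a b z t := by
  have h := hy.deriv_sub_ae hz
  filter_upwards [h, ae_comp_sub h 1] with t h1 h2
  simp only [nddeLinear, h1, h2]
  ring

end

/-! ### Existence of small solutions -/

section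

variable {c a b ω T m η ρ r : ℝ} {p q y s : ℝ → ℝ}

/-- If `z` and `z'` solve the linear equation whose right-hand sides contain the nonlinearity
evaluated at `y` and `y'`, then `z - z'` is at most half as large as `y - y'` in `L²`. -/
theorem MemH1Per.integral_sq_sub_le_of_nddeLinear_eq (hTω : ω * T = 2 * Real.pi) (hT : 0 < T)
    (hm : 0 < m) (hσ : ∀ k, m ≤ ‖nddeSymbol c a b ω k‖) (hp : ContDiff ℝ 1 p)
    (hq : ContDiff ℝ 1 q) (hpη : ∀ x, |x| ≤ ρ → |deriv p x| ≤ η)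
    (hqη : ∀ x, |x| ≤ ρ → |deriv q x| ≤ η) (hηm : 16 * η ^ 2 ≤ m ^ 2) {y y' z z' : ℝ → ℝ}
    (hy : MemH1Per T y) (hy' : MemH1Per T y') (hz : MemH1Per T z) (hz' : MemH1Per T z')
    (hyρ : ∀ t, |y t| ≤ ρ) (hyρ' : ∀ t, |y' t| ≤ ρ)
    (hzy : nddeLinear c a b z =ᵐ[volume] fun t => s t - (p (y t) + q (y (t - 1))))
    (hzy' : nddeLinear c a b z' =ᵐ[volume] fun t => s t - (p (y' t) + q (y' (t - 1)))) :
    ∫ t in (0 : ℝ)..T, (z t - z' t) ^ 2 ≤ (1 / 2) ^ 2 * ∫ t in (0 : ℝ)..T, (y t - y' t) ^ 2 := by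
  have h1 := (hz.sub hz').sq_mul_integral_sq_le hTω hT hm hσ
  have h2 := hy.integral_sq_remainder_sub_le hT hp hq hpη hqη hy' hyρ hyρ'
  have h3 : ∫ t in (0 : ℝ)..T, nddeLinear c a b (fun t => z t - z' t) t ^ 2 =
      ∫ t in (0 : ℝ)..T, ((p (y t) + q (y (t - 1))) - (p (y' t) + q (y' (t - 1)))) ^ 2 := by
    refine intervalIntegral.integral_congr_ae ?_
    filter_upwards [hz.nddeLinear_sub_ae c a b hz', hzy, hzy'] with t e1 e2 e3 _
    rw [e1, e2, e3]
    ring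
  have h4 : 0 ≤ ∫ t in (0 : ℝ)..T, (y t - y' t) ^ 2 :=
    intervalIntegral.integral_nonneg hT.le fun _ _ => sq_nonneg _
  rw [h3] at h1
  have hm2 : 0 < m ^ 2 := by positivity
  refine le_of_mul_le_mul_left (h1.trans (h2.trans ?_)) hm2
  nlinarith

/-- The Fourier coefficients of the real functions in a ball of `H^1_♯`, as a set in `ℓ²`. The
bound is required of all finite partial sums, which makes it evident that the set is closed for
the `ℓ²` norm. -/
def h1CoeffBall (ω r : ℝ) : Set (lp (fun _ : ℤ => ℂ) 2) :=
  {x | (∀ k, x (-k) = (starRingEnd ℂ) (x k)) ∧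
    ∀ F : Finset ℤ, ∑ k ∈ F, (1 + ((k : ℝ) * ω) ^ 2) * ‖x k‖ ^ 2 ≤ r}

theorem isClosed_h1CoeffBall (ω r : ℝ) : IsClosed (h1CoeffBall ω r) := by
  have hcont : ∀ k : ℤ, Continuous fun x : lp (fun _ : ℤ => ℂ) 2 => x k := fun k =>
    (continuous_apply k).comp (lp.uniformContinuous_coe (p := 2)).continuous
  have e : h1CoeffBall ω r = (⋂ k : ℤ, {x | x (-k) = (starRingEnd ℂ) (x k)}) ∩
      ⋂ F : Finset ℤ, {x | ∑ k ∈ F, (1 + ((k : ℝ) * ω) ^ 2) * ‖x k‖ ^ 2 ≤ r} := by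
    ext x
    simp [h1CoeffBall]
  rw [e]
  refine (isClosed_iInter fun k => ?_).inter (isClosed_iInter fun F => ?_)
  · exact isClosed_eq (hcont _) (Complex.continuous_conj.comp (hcont k))
  · exact isClosed_le (continuous_finsetSum _ fun k _ =>
      continuous_const.mul ((hcont k).norm.pow 2)) continuous_const

theorem lp_hasSum_sq (x : lp (fun _ : ℤ => ℂ) 2) : HasSum (fun k => ‖x k‖ ^ 2) (‖x‖ ^ 2) := by
  simpa using lp.hasSum_norm (p := 2) (by norm_num) x

theorem MemH1Per.hasSum_h1PerSq (hTω : ω * T = 2 * Real.pi) (hT : 0 < T) (hy : MemH1Per T y) :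
    HasSum (fun k : ℤ => (1 + ((k : ℝ) * ω) ^ 2) * ‖perCoeff ω T y k‖ ^ 2)
      (T⁻¹ * h1PerSq T y) := by
  have h1 := hy.memL2Per.hasSum_sq_perCoeff hTω hT
  have h2 := hy.memL2Per_deriv.hasSum_sq_perCoeff hTω hT
  rw [h1PerSq, mul_add]
  convert h1.add h2 using 2 with k
  rw [hy.perCoeff_deriv hTω hT]
  simp [mul_pow, add_mul]

/-- The elements of the coefficient ball are the coefficients of functions in the ball of
`H^1_♯`. -/
theorem exists_memH1Per_of_mem_h1CoeffBall (hTω : ω * T = 2 * Real.pi) (hT : 0 < T)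
    {x : lp (fun _ : ℤ => ℂ) 2} (hx : x ∈ h1CoeffBall ω (T⁻¹ * r)) :
    ∃ y, MemH1Per T y ∧ (∀ k, perCoeff ω T y k = x k) ∧ h1PerSq T y ≤ r := by
  have hsum : Summable fun k : ℤ => (1 + ((k : ℝ) * ω) ^ 2) * ‖x k‖ ^ 2 :=
    summable_of_sum_le (fun k => by positivity) hx.2
  obtain ⟨y, hy, hyx⟩ := exists_memH1Per_perCoeff_eq hTω hT (fun k => x k)
    (hsum.of_nonneg_of_le (fun k => by positivity) fun k => by
      have := sq_nonneg ‖x k‖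
      nlinarith) hx.1
  refine ⟨y, hy, hyx, ?_⟩
  have h := hy.hasSum_h1PerSq hTω hT
  simp only [hyx] at h
  exact le_of_mul_le_mul_left (hasSum_le_of_sum_le h hx.2) (inv_pos.2 hT)

/-- Conversely, the coefficients of a function in the ball of `H^1_♯` lie in the coefficient
ball. -/
theorem MemH1Per.exists_mem_h1CoeffBall (hTω : ω * T = 2 * Real.pi) (hT : 0 < T)
    (hy : MemH1Per T y) (hr : h1PerSq T y ≤ r) :
    ∃ x ∈ h1CoeffBall ω (T⁻¹ * r), ∀ k, perCoeff ω T y k = x k := by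
  have hmem : Memℓp (perCoeff ω T y) 2 := by
    rw [memℓp_gen_iff (by norm_num)]
    simpa using (hy.memL2Per.hasSum_sq_perCoeff hTω hT).summable
  refine ⟨⟨perCoeff ω T y, hmem⟩, ⟨fun k => perCoeff_neg y k, fun F => ?_⟩, fun k => rfl⟩
  have h := hy.hasSum_h1PerSq hTω hT
  refine (sum_le_hasSum F (fun k _ => by positivity) h).trans ?_
  exact mul_le_mul_of_nonneg_left hr (inv_pos.2 hT).le

/-- Existence of a small solution. The map sending `y` to the solution `z` of the linear equation
with right-hand side `s - p(y) - q(y(· - 1))` preserves a ball of `H^1_♯` and contracts it for the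
`L²` distance, for which that ball is complete. -/
theorem exists_nddeLinear_ae_eq_source_sub (hTω : ω * T = 2 * Real.pi) (hT : 0 < T)
    (hm : 0 < m) (hσ : ∀ k, m ≤ ‖nddeSymbol c a b ω k‖) (hp : ContDiff ℝ 1 p)
    (hq : ContDiff ℝ 1 q) (hp0 : p 0 = 0) (hq0 : q 0 = 0) (hρ : 0 ≤ ρ)
    (hpη : ∀ x, |x| ≤ ρ → |deriv p x| ≤ η)
    (hqη : ∀ x, |x| ≤ ρ → |deriv q x| ≤ η) (hηm : 16 * η ^ 2 ≤ m ^ 2) (hr : 0 ≤ r)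
    (hrρ : (1 / T + 1) * r ≤ ρ ^ 2) (hs : MemH1Per T s) (hsr : 4 * h1PerSq T s ≤ m ^ 2 * r) :
    ∃ y, MemH1Per T y ∧ h1PerSq T y ≤ r ∧
      nddeLinear c a b y =ᵐ[volume] fun t => s t - (p (y t) + q (y (t - 1))) := by
  have hsup : ∀ {y : ℝ → ℝ}, MemH1Per T y → h1PerSq T y ≤ r → ∀ t, |y t| ≤ ρ := by
    intro y hy hyr t
    refine abs_le_of_sq_le_sq ((hy.sq_le_mul_h1PerSq hT t).trans (le_trans ?_ hrρ)) hρ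
    gcongr
  have hball : ∀ x : h1CoeffBall ω (T⁻¹ * r), ∃ y, MemH1Per T y ∧
      (∀ k, perCoeff ω T y k = x.1 k) ∧ h1PerSq T y ≤ r :=
    fun x => exists_memH1Per_of_mem_h1CoeffBall hTω hT x.2
  choose Y hY hYx hYr using hball
  have hsolve : ∀ x : h1CoeffBall ω (T⁻¹ * r), ∃ z, MemH1Per T z ∧
      (nddeLinear c a b z =ᵐ[volume] fun t => s t - (p (Y x t) + q (Y x (t - 1)))) ∧
      h1PerSq T z ≤ r := by
    intro x
    obtain ⟨z, hz, hzae, h1, h2⟩ := exists_nddeLinear_ae_eq hTω hT hm hσ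
      (hs.sub ((hY x).remainder hT hp hq))
    refine ⟨z, hz, hzae, ?_⟩
    have h3 := hs.h1PerSq_source_sub_remainder_le hT hp hq hp0 hq0 hρ hpη hqη (hY x)
      (hsup (hY x) (hYr x))
    have h4 : m ^ 2 * h1PerSq T z ≤
        h1PerSq T (fun t => s t - (p (Y x t) + q (Y x (t - 1)))) := by
      simp only [h1PerSq]
      linarith
    have h5 := h1PerSq_nonneg hT (Y x)
    refine le_of_mul_le_mul_left (h4.trans (h3.trans ?_)) (by positivity : 0 < m ^ 2)
    nlinarith [hYr x, sq_nonneg η]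
  choose Z hZ hZae hZr using hsolve
  have hcoef : ∀ x : h1CoeffBall ω (T⁻¹ * r), ∃ x' : h1CoeffBall ω (T⁻¹ * r),
      ∀ k, perCoeff ω T (Z x) k = x'.1 k := fun x => by
    obtain ⟨x', hx', h⟩ := (hZ x).exists_mem_h1CoeffBall hTω hT (hZr x)
    exact ⟨⟨x', hx'⟩, h⟩
  choose G hG using hcoef
  have hdist : ∀ {u v : ℝ → ℝ} {x x' : lp (fun _ : ℤ => ℂ) 2}, MemH1Per T u → MemH1Per T v →
      (∀ k, perCoeff ω T u k = x k) → (∀ k, perCoeff ω T v k = x' k) →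
      dist x x' ^ 2 = T⁻¹ * ∫ t in (0 : ℝ)..T, (u t - v t) ^ 2 := by
    intro u v x x' hu hv hx hx'
    have h1 := (hu.memL2Per.sub hv.memL2Per).hasSum_sq_perCoeff hTω hT
    have h2 := lp_hasSum_sq (x - x')
    rw [dist_eq_norm]
    refine h2.unique ?_
    convert h1 using 3 with k
    rw [perCoeff_sub hT hu.memL2Per hv.memL2Per, hx, hx']
    rfl
  have hlip : LipschitzWith (1 / 2) G := by
    refine LipschitzWith.of_dist_le_mul fun x x' => ?_
    have h1 := hdist (hZ x) (hZ x') (hG x) (hG x')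
    have h2 := hdist (hY x) (hY x') (hYx x) (hYx x')
    have h3 := MemH1Per.integral_sq_sub_le_of_nddeLinear_eq hTω hT hm hσ hp hq hpη hqη hηm
      (hY x) (hY x') (hZ x) (hZ x') (hsup (hY x) (hYr x)) (hsup (hY x') (hYr x')) (hZae x) (hZae x')
    rw [Subtype.dist_eq, Subtype.dist_eq]
    refine le_of_sq_le_sq ?_ (by positivity)
    rw [mul_pow, h1, h2, mul_left_comm]
    push_cast
    exact mul_le_mul_of_nonneg_left h3 (inv_pos.2 hT).le
  have hcontr : ContractingWith (1 / 2) G := ⟨by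
    rw [← NNReal.coe_lt_coe]; push_cast; norm_num, hlip⟩
  have : CompleteSpace (h1CoeffBall ω (T⁻¹ * r)) :=
    (isClosed_h1CoeffBall ω (T⁻¹ * r)).completeSpace_coe
  have : Nonempty (h1CoeffBall ω (T⁻¹ * r)) :=
    ⟨⟨0, fun k => by simp, fun F => by simpa using mul_nonneg (inv_pos.2 hT).le hr⟩⟩
  obtain ⟨x, hx⟩ : ∃ x, G x = x := ⟨_, hcontr.fixedPoint_isFixedPt⟩
  -- at the fixed point `Y x` and `Z x` have the same coefficients, hence coincide
  have hYZ : Y x = Z x := by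
    have hae := (hY x).memL2Per.ae_eq_of_perCoeff_eq hTω hT (hZ x).memL2Per fun k => by
      rw [hYx, hG, hx]
    exact ((hY x).continuous.ae_eq_iff_eq volume (hZ x).continuous).1 hae
  have hZx := hZae x
  rw [hYZ] at hZx
  exact ⟨Z x, hZ x, hZr x, hZx⟩

end

/-! ### The energy estimate -/

section

variable {c γ T lam κ : ℝ} {f g p y s : ℝ → ℝ}

/-- Along a periodic function `y`, the functions `y'` and `p(y)` are orthogonal in `L²`. -/
theorem MemH1Per.integral_sq_mul_deriv_add_comp (hT : 0 < T) (hy : MemH1Per T y)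
    (hp : Continuous p) (c : ℝ) :
    ∫ t in (0 : ℝ)..T, (c * deriv y t + p (y t)) ^ 2 =
      c ^ 2 * (∫ t in (0 : ℝ)..T, deriv y t ^ 2) + ∫ t in (0 : ℝ)..T, p (y t) ^ 2 := by
  have hPd : ∀ x, HasDerivAt (fun x => ∫ u in (0 : ℝ)..x, p u) (p x) x := fun x =>
    intervalIntegral.integral_hasDerivAt_right (hp.intervalIntegrable _ _)
      hp.stronglyMeasurable.stronglyMeasurableAtFilter hp.continuousAt
  have hPd' : deriv (fun x => ∫ u in (0 : ℝ)..x, p u) = p := funext fun x => (hPd x).deriv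
  have hP : ContDiff ℝ 1 (fun x => ∫ u in (0 : ℝ)..x, p u) := by
    rw [contDiff_one_iff_deriv, hPd']
    exact ⟨fun x => (hPd x).differentiableAt, hp⟩
  have hcross : ∫ t in (0 : ℝ)..T, p (y t) * deriv y t = 0 := by
    refine Eq.trans ?_ (hy.comp hP).integral_deriv_period
    refine intervalIntegral.integral_congr_ae ?_
    filter_upwards [hy.deriv_comp_ae hP] with t ht _
    rw [ht, hPd']
  have hpy : MemL2Per T (fun t => p (y t)) :=
    .of_continuous (fun t => by simp only [hy.periodic t]) (hp.comp hy.continuous)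
  have h1 := (hy.memL2Per_deriv.intervalIntegrable_sq hT 0 T).const_mul (c ^ 2)
  have h2 := hpy.intervalIntegrable_sq hT 0 T
  have h3 := (hpy.intervalIntegrable_mul hT hy.memL2Per_deriv 0 T).const_mul (2 * c)
  have e : ∀ t, (c * deriv y t + p (y t)) ^ 2 =
      c ^ 2 * deriv y t ^ 2 + p (y t) ^ 2 + 2 * c * (p (y t) * deriv y t) := fun t => by ring
  simp only [e]
  rw [intervalIntegral.integral_add (h1.add h2) h3, intervalIntegral.integral_add h1 h2,
    intervalIntegral.integral_const_mul, intervalIntegral.integral_const_mul, hcross, mul_zero,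
    add_zero]

/-- The energy estimate. With `u = y' + f(y)` and `v = c y'(· - 1) + g(y(· - 1))` the equation is
`u + v = s`, and the difference of the `L²` norms of `u` and `v` is that of `f(y)` and `g(y)`. -/
theorem MemH1Per.energy_estimate (hT : 0 < T) (hc : c = 1 ∨ c = -1) (hf : Continuous f)
    (hg : Continuous g) (hgf : ∀ x, |g x| ≤ γ * |f x|) (hy : MemH1Per T y)
    (hs : MemH1Per T s) (hsol : SolvesNDDE c f g s y) (hlam : 0 < lam) :
    (1 - γ ^ 2) * (∫ t in (0 : ℝ)..T, f (y t) ^ 2) ≤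
      lam * ((∫ t in (0 : ℝ)..T, deriv y t ^ 2) + ∫ t in (0 : ℝ)..T, f (y t) ^ 2)
        + 1 / lam * ∫ t in (0 : ℝ)..T, s t ^ 2 := by
  have hfy : MemL2Per T (fun t => f (y t)) :=
    .of_continuous (fun t => by simp only [hy.periodic t]) (hf.comp hy.continuous)
  have hgy : MemL2Per T (fun t => g (y t)) :=
    .of_continuous (fun t => by simp only [hy.periodic t]) (hg.comp hy.continuous)
  have hu : MemL2Per T (fun t => deriv y t + f (y t)) := hy.memL2Per_deriv.add hfy
  have hv0 : MemL2Per T (fun t => c * deriv y t + g (y t)) :=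
    (hy.memL2Per_deriv.const_mul c).add hgy
  have hv := hv0.comp_sub hT 1
  have hu2 := hy.integral_sq_mul_deriv_add_comp hT hf 1
  have hv2 := hy.integral_sq_mul_deriv_add_comp hT hg c
  have hc2 : c ^ 2 = 1 := by rcases hc with rfl | rfl <;> norm_num
  rw [hc2, one_mul] at hv2
  simp only [one_pow, one_mul] at hu2
  have hshift := intervalIntegral_comp_sub_of_periodic
    (T := T) (u := fun t => (c * deriv y t + g (y t)) ^ 2)
    (fun t => by simp only [hy.periodic t, hy.periodic_deriv t]) 1
  have hgle : ∫ t in (0 : ℝ)..T, g (y t) ^ 2 ≤ γ ^ 2 * ∫ t in (0 : ℝ)..T, f (y t) ^ 2 := by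
    refine hgy.integral_sq_mono hT hfy (.of_forall fun t => ?_)
    have := pow_le_pow_left₀ (abs_nonneg _) (hgf (y t)) 2
    rwa [mul_pow, sq_abs, sq_abs] at this
  have hdiff : (∫ t in (0 : ℝ)..T, (deriv y t + f (y t)) ^ 2) -
      (∫ t in (0 : ℝ)..T, (c * deriv y (t - 1) + g (y (t - 1))) ^ 2) ≤
      lam * (∫ t in (0 : ℝ)..T, (deriv y t + f (y t)) ^ 2)
        + 1 / lam * ∫ t in (0 : ℝ)..T, s t ^ 2 := by
    have i1 := hu.intervalIntegrable_sq hT 0 T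
    have i2 := hs.memL2Per.intervalIntegrable_sq hT 0 T
    have i3 := hv.intervalIntegrable_sq hT 0 T
    rw [← intervalIntegral.integral_sub i1 i3, ← intervalIntegral.integral_const_mul,
      ← intervalIntegral.integral_const_mul,
      ← intervalIntegral.integral_add (i1.const_mul _) (i2.const_mul _)]
    refine intervalIntegral.integral_mono_ae hT.le (i1.sub i3)
      ((i1.const_mul _).add (i2.const_mul _)) ?_
    filter_upwards [hsol] with t ht
    have hvt : c * deriv y (t - 1) + g (y (t - 1)) = s t - (deriv y t + f (y t)) := by
      rw [← ht]
      ring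
    rw [hvt]
    -- `u² - v² = (2 u - s) s ≤ 2 u s`
    have h := mul_nonneg (one_div_pos.2 hlam).le (sq_nonneg (lam * (deriv y t + f (y t)) - s t))
    have e : 1 / lam * (lam * (deriv y t + f (y t)) - s t) ^ 2 =
        lam * (deriv y t + f (y t)) ^ 2 + 1 / lam * s t ^ 2 - 2 * (deriv y t + f (y t)) * s t := by
      field
    nlinarith [sq_nonneg (s t)]
  rw [hshift, hu2, hv2] at hdiff
  linarith

/-- In a bounded set of `H^1_♯`, solutions with small sources are small in `L²`. -/
theorem exists_integral_sq_le_of_solvesNDDE (hT : 0 < T) (hc : c = 1 ∨ c = -1)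
    (hf : ContDiff ℝ 1 f) (hf' : ∀ x, 0 < deriv f x) (hf0 : f 0 = 0) (hg : Continuous g)
    (hγ0 : 0 ≤ γ) (hγ1 : γ < 1) (hgf : ∀ x, |g x| ≤ γ * |f x|) (R : ℝ) (hκ : 0 < κ) :
    ∃ ε : ℝ, 0 < ε ∧ ∀ s y, MemH1Per T s → MemH1Per T y → h1PerSq T s ≤ ε →
      h1PerSq T y ≤ R → SolvesNDDE c f g s y → ∫ t in (0 : ℝ)..T, y t ^ 2 ≤ κ := by
  set A := Real.sqrt ((1 / T + 1) * R) with hA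
  have hfd := hf.continuous_deriv le_rfl
  have hne : (Set.Icc (-A) A).Nonempty := ⟨0, by
    have := Real.sqrt_nonneg ((1 / T + 1) * R)
    constructor <;> linarith⟩
  obtain ⟨x₁, -, hx₁⟩ := isCompact_Icc.exists_isMinOn hne hfd.continuousOn
  obtain ⟨x₂, -, hx₂⟩ := isCompact_Icc.exists_isMaxOn hne hfd.continuousOn
  have hmin : ∀ x ∈ Set.Icc (-A) A, deriv f x₁ ≤ deriv f x := fun x hx => hx₁ hx
  have hmax : ∀ x ∈ Set.Icc (-A) A, deriv f x ≤ deriv f x₂ := fun x hx => hx₂ hx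
  set m₀ := deriv f x₁ with hm₀
  set M₀ := deriv f x₂ with hM₀
  have hm₀0 : 0 < m₀ := hf' x₁
  have hM₀0 : 0 < M₀ := hf' x₂
  have h0mem : (0 : ℝ) ∈ Set.Icc (-A) A := ⟨by
    have := Real.sqrt_nonneg ((1 / T + 1) * R)
    linarith, Real.sqrt_nonneg _⟩
  -- `f` is comparable to the identity on the range of `y`
  have hflow : ∀ x ∈ Set.Icc (-A) A, m₀ ^ 2 * x ^ 2 ≤ f x ^ 2 := by
    intro x hx
    have hmvt : ∀ u v : ℝ, u ∈ Set.Icc (-A) A → v ∈ Set.Icc (-A) A → u ≤ v →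
        m₀ * (v - u) ≤ f v - f u := fun u v hu hv huv =>
      (convex_Icc (-A) A).mul_sub_le_image_sub_of_le_deriv hf.continuous.continuousOn
        (hf.differentiable one_ne_zero).differentiableOn
        (fun z hz => hmin z (interior_subset hz)) u hu v hv huv
    rw [← mul_pow]
    rcases le_total 0 x with h | h
    · have := hmvt 0 x h0mem hx h
      rw [hf0] at this
      exact pow_le_pow_left₀ (by positivity) (by linarith) 2
    · have := hmvt x 0 hx h0mem h
      rw [hf0] at this
      have h2 : (-(m₀ * x)) ^ 2 ≤ (-f x) ^ 2 :=
        pow_le_pow_left₀ (by nlinarith) (by linarith) 2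
      simpa using h2
  have hfup : ∀ x ∈ Set.Icc (-A) A, f x ^ 2 ≤ M₀ ^ 2 * x ^ 2 := by
    intro x hx
    have := sq_sub_le_of_abs_deriv_le (ρ := A) (η := M₀) hf (fun z hz => by
      rw [abs_of_pos (hf' z)]
      exact hmax z (abs_le.1 hz)) (abs_le.2 hx) (abs_le.2 h0mem)
    simpa [hf0] using this
  set U := (1 + M₀ ^ 2) * |R| with hU
  have hU0 : 0 ≤ U := by positivity
  set B := (1 - γ ^ 2) * m₀ ^ 2 with hB
  have hB0 : 0 < B := mul_pos (by nlinarith) (by positivity)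
  set lam := B * κ / (2 * (U + 1)) with hlam
  have hlam0 : 0 < lam := by positivity
  refine ⟨lam * (B * κ / 2), by positivity, fun s y hs hy hsε hyR hsol => ?_⟩
  have hE := hy.energy_estimate hT hc hf.continuous hg hgf hs hsol hlam0
  have hmem : ∀ t, y t ∈ Set.Icc (-A) A := by
    intro t
    refine abs_le.1 (Real.abs_le_sqrt ((hy.sq_le_mul_h1PerSq hT t).trans ?_))
    gcongr
  have hfy : MemL2Per T (fun t => f (y t)) := (hy.comp hf).memL2Per
  have h1 : m₀ ^ 2 * (∫ t in (0 : ℝ)..T, y t ^ 2) ≤ ∫ t in (0 : ℝ)..T, f (y t) ^ 2 := by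
    rw [← intervalIntegral.integral_const_mul]
    exact intervalIntegral.integral_mono hT.le
      ((hy.memL2Per.intervalIntegrable_sq hT 0 T).const_mul _)
      (hfy.intervalIntegrable_sq hT 0 T) fun t => hflow _ (hmem t)
  have h2 : ∫ t in (0 : ℝ)..T, f (y t) ^ 2 ≤ M₀ ^ 2 * ∫ t in (0 : ℝ)..T, y t ^ 2 :=
    hfy.integral_sq_mono hT hy.memL2Per (.of_forall fun t => hfup _ (hmem t))
  have hy0 : 0 ≤ ∫ t in (0 : ℝ)..T, y t ^ 2 :=
    intervalIntegral.integral_nonneg hT.le fun _ _ => sq_nonneg _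
  have hyd0 : 0 ≤ ∫ t in (0 : ℝ)..T, deriv y t ^ 2 :=
    intervalIntegral.integral_nonneg hT.le fun _ _ => sq_nonneg _
  have hsd0 : 0 ≤ ∫ t in (0 : ℝ)..T, deriv s t ^ 2 :=
    intervalIntegral.integral_nonneg hT.le fun _ _ => sq_nonneg _
  simp only [h1PerSq] at hyR hsε
  have h3 : (∫ t in (0 : ℝ)..T, deriv y t ^ 2) + ∫ t in (0 : ℝ)..T, f (y t) ^ 2 ≤ U := by
    have := le_abs_self R
    rw [hU]
    nlinarith [sq_nonneg M₀]
  have h4 : lam * ((∫ t in (0 : ℝ)..T, deriv y t ^ 2) + ∫ t in (0 : ℝ)..T, f (y t) ^ 2) ≤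
      B * κ / 2 := by
    refine (mul_le_mul_of_nonneg_left h3 hlam0.le).trans ?_
    rw [hlam, div_mul_eq_mul_div, div_le_iff₀ (by positivity)]
    nlinarith [mul_pos hB0 hκ]
  have h5 : 1 / lam * (∫ t in (0 : ℝ)..T, s t ^ 2) ≤ B * κ / 2 := by
    rw [one_div_mul_eq_div, div_le_iff₀ hlam0]
    linarith
  have h6 : B * (∫ t in (0 : ℝ)..T, y t ^ 2) ≤ (1 - γ ^ 2) * ∫ t in (0 : ℝ)..T, f (y t) ^ 2 := by
    rw [hB, mul_assoc]
    exact mul_le_mul_of_nonneg_left h1 (by nlinarith)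
  refine le_of_mul_le_mul_left ?_ hB0
  linarith

/-- In a bounded set of `H^1_♯`, solutions with small sources are uniformly small. -/
theorem exists_abs_le_of_solvesNDDE (hT : 0 < T) (hc : c = 1 ∨ c = -1)
    (hf : ContDiff ℝ 1 f) (hf' : ∀ x, 0 < deriv f x) (hf0 : f 0 = 0) (hg : Continuous g)
    (hγ0 : 0 ≤ γ) (hγ1 : γ < 1) (hgf : ∀ x, |g x| ≤ γ * |f x|) {R ρ : ℝ} (hR : 0 < R)
    (hρ : 0 < ρ) :
    ∃ ε : ℝ, 0 < ε ∧ ∀ s y, MemH1Per T s → MemH1Per T y → h1PerSq T s ≤ ε →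
      h1PerSq T y ≤ R → SolvesNDDE c f g s y → ∀ t, |y t| ≤ ρ := by
  set l := 2 * R / ρ ^ 2 with hl
  have hl0 : 0 < l := by positivity
  obtain ⟨ε, hε, h⟩ := exists_integral_sq_le_of_solvesNDDE hT hc hf hf' hf0 hg hγ0 hγ1 hgf R
    (κ := ρ ^ 2 / 2 / (1 / T + l)) (by positivity)
  refine ⟨ε, hε, fun s y hs hy hsε hyR hsol t => ?_⟩
  have h1 := h s y hs hy hsε hyR hsol
  have h2 := hy.sq_le hT hl0 t
  have hy0 : 0 ≤ ∫ t in (0 : ℝ)..T, y t ^ 2 :=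
    intervalIntegral.integral_nonneg hT.le fun _ _ => sq_nonneg _
  rw [le_div_iff₀ (by positivity)] at h1
  have h3 : 1 / l * (∫ t in (0 : ℝ)..T, deriv y t ^ 2) ≤ ρ ^ 2 / 2 := by
    simp only [h1PerSq] at hyR
    rw [one_div_mul_eq_div, div_le_iff₀ hl0, hl]
    have : ρ ^ 2 / 2 * (2 * R / ρ ^ 2) = R := by field
    linarith
  refine abs_le_of_sq_le_sq ?_ hρ.le
  linarith

end

/-! ### Existence and uniqueness -/

/-- The equation in terms of its linearisation at the origin. -/
theorem solvesNDDE_iff_nddeLinear_ae_eq (c a b : ℝ) (f g s y : ℝ → ℝ) :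
    SolvesNDDE c f g s y ↔ nddeLinear c a b y =ᵐ[volume] fun t =>
      s t - ((fun x => f x - a * x) (y t) + (fun x => g x - b * x) (y (t - 1))) := by
  refine Filter.eventually_congr (.of_forall fun t => ?_)
  simp only [nddeLinear]
  constructor <;> intro h <;> linarith

/-- Near the origin the derivative of `f x - f'(0) x` is small. -/
theorem exists_abs_deriv_sub_mul_le {f : ℝ → ℝ} (hf : ContDiff ℝ 1 f) {η : ℝ} (hη : 0 < η) :
    ∃ ρ : ℝ, 0 < ρ ∧ ∀ x, |x| ≤ ρ → |deriv (fun x => f x - deriv f 0 * x) x| ≤ η := by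
  have hc : ContinuousAt (deriv f) 0 := (hf.continuous_deriv le_rfl).continuousAt
  obtain ⟨ρ, hρ, h⟩ := Metric.continuousAt_iff.1 hc η hη
  refine ⟨ρ / 2, by positivity, fun x hx => ?_⟩
  have hd : deriv (fun x => f x - deriv f 0 * x) x = deriv f x - deriv f 0 := by
    have h1 := (hf.differentiable one_ne_zero x).hasDerivAt
    have h2 := (hasDerivAt_id x).const_mul (deriv f 0)
    simpa using (h1.fun_sub h2).deriv
  rw [hd]
  have := h (x := x) (by rw [Real.dist_eq, sub_zero]; linarith)
  rw [Real.dist_eq] at this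
  exact this.le

theorem mainTheorem3 (c : ℝ) (hc : c = 1 ∨ c = -1)
    (f g : ℝ → ℝ)
    (hf : ContDiff ℝ 1 f) (hf' : ∀ x, 0 < deriv f x) (hf0 : f 0 = 0)
    (hg : ContDiff ℝ 1 g)
    (γ : ℝ) (hγ0 : 0 ≤ γ) (hγ1 : γ < 1)
    (hgf : ∀ x, |g x| ≤ γ * |f x|)
    (hgf' : ∀ x, |deriv g x| ≤ γ * |deriv f x|)
    (ω T : ℝ) (hT : 0 < T) (hTω : T = 2 * Real.pi / ω)
    (φ : ℤ → ℤ)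
    (hφ : ∀ k n : ℤ,
      |(k : ℝ) * ω - rootFreq c (φ k)| ≤ |(k : ℝ) * ω - rootFreq c n|)
    (d : ℝ) (hd : d = deriv f 0 - c * deriv g 0)
    (hdioph : 0 < Filter.liminf
      (fun k : ℤ =>
        ((|d - rootFreq c (φ k) * ((k : ℝ) * ω - rootFreq c (φ k))| : ℝ) : EReal))
      Filter.cofinite) :
    ∀ R : ℝ, 0 < R → ∃ ε : ℝ, 0 < ε ∧
      ∀ s : ℝ → ℝ, MemH1Per T s → h1PerNorm T s ≤ ε →
        ∃! y : ℝ → ℝ, MemH1Per T y ∧ h1PerNorm T y ≤ R ∧ SolvesNDDE c f g s y := by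
  intro R hR
  subst hd
  have hω : 0 < ω := by
    rw [hTω] at hT
    exact (div_pos_iff_of_pos_left (by positivity)).1 hT
  have hTω' : ω * T = 2 * Real.pi := by rw [hTω, mul_div_cancel₀ _ hω.ne']
  have hab : |deriv g 0| < deriv f 0 := by
    have h1 := hgf' 0
    rw [abs_of_pos (hf' 0)] at h1
    have := hf' 0
    nlinarith
  have hg0 : g 0 = 0 := by
    have := hgf 0
    rw [hf0, abs_zero, mul_zero] at this
    exact abs_nonpos_iff.1 this
  obtain ⟨m, hm, hσ⟩ := exists_le_norm_nddeSymbol hc hab hω φ hφ hdioph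
  have hp : ContDiff ℝ 1 (fun x => f x - deriv f 0 * x) := hf.sub (contDiff_const.mul contDiff_id)
  have hq : ContDiff ℝ 1 (fun x => g x - deriv g 0 * x) := hg.sub (contDiff_const.mul contDiff_id)
  obtain ⟨ρ₁, hρ₁, hpη⟩ := exists_abs_deriv_sub_mul_le hf (η := m / 4) (by positivity)
  obtain ⟨ρ₂, hρ₂, hqη⟩ := exists_abs_deriv_sub_mul_le hg (η := m / 4) (by positivity)
  set ρ := min ρ₁ ρ₂ with hρdef
  have hρ : 0 < ρ := lt_min hρ₁ hρ₂
  replace hpη : ∀ x, |x| ≤ ρ → |deriv (fun x => f x - deriv f 0 * x) x| ≤ m / 4 :=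
    fun x hx => hpη x (hx.trans (min_le_left _ _))
  replace hqη : ∀ x, |x| ≤ ρ → |deriv (fun x => g x - deriv g 0 * x) x| ≤ m / 4 :=
    fun x hx => hqη x (hx.trans (min_le_right _ _))
  have hηm : 16 * (m / 4) ^ 2 ≤ m ^ 2 := le_of_eq (by ring)
  -- the squared radius of a ball of `H^1_♯` inside the given one, with values in `[-ρ, ρ]`
  set r := min (R ^ 2) (ρ ^ 2 / (1 / T + 1)) with hr
  have hr0 : 0 < r := lt_min (by positivity) (by positivity)
  have hrρ : (1 / T + 1) * r ≤ ρ ^ 2 := by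
    have := min_le_right (R ^ 2) (ρ ^ 2 / (1 / T + 1))
    rw [le_div_iff₀ (by positivity), mul_comm] at this
    exact this
  obtain ⟨ε₁, hε₁, hsmall⟩ := exists_abs_le_of_solvesNDDE hT hc hf hf' hf0 hg.continuous hγ0 hγ1
    hgf (R := R ^ 2) (by positivity) hρ
  set ε₂ := min ε₁ (m ^ 2 * r / 4) with hε₂
  have hε₂0 : 0 < ε₂ := lt_min hε₁ (by positivity)
  refine ⟨Real.sqrt ε₂, Real.sqrt_pos.2 hε₂0, fun s hs hsε => ?_⟩
  rw [hs.h1PerNorm_le_iff hT (Real.sqrt_nonneg _), Real.sq_sqrt hε₂0.le] at hsε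
  have hsε₁ := hsε.trans (min_le_left _ _)
  have hsε₂ := hsε.trans (min_le_right _ _)
  obtain ⟨y, hy, hyr, hyeq⟩ := exists_nddeLinear_ae_eq_source_sub hTω' hT hm hσ hp hq
    (by simp [hf0]) (by simp [hg0]) hρ.le hpη hqη hηm hr0.le hrρ hs (by linarith)
  have hysol := (solvesNDDE_iff_nddeLinear_ae_eq c (deriv f 0) (deriv g 0) f g s y).2 hyeq
  have hyR : h1PerSq T y ≤ R ^ 2 := hyr.trans (min_le_left _ _)
  refine ⟨y, ⟨hy, (hy.h1PerNorm_le_iff hT hR.le).2 hyR, hysol⟩, ?_⟩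
  rintro z ⟨hz, hzR, hzsol⟩
  rw [hz.h1PerNorm_le_iff hT hR.le] at hzR
  have hzeq := (solvesNDDE_iff_nddeLinear_ae_eq c (deriv f 0) (deriv g 0) f g s z).1 hzsol
  have hcontr := MemH1Per.integral_sq_sub_le_of_nddeLinear_eq hTω' hT hm hσ hp hq hpη hqη hηm
    hz hy hz hy (hsmall s z hs hz hsε₁ hzR hzsol) (hsmall s y hs hy hsε₁ hyR hysol) hzeq hyeq
  ext t
  exact sub_eq_zero.1 ((hz.sub hy).eq_zero_of_integral_sq_le_zero hT (by linarith) t)
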